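/- Let $X$ be a compact complex manifold of complex dimension $n\ge 3$ which is homogeneous, in the following sense: there are a complex manifold $Y$, a group $G$ acting transitively on $Y$ by biholomorphisms, and a surjective local biholomorphism $\pi:Y\to X$. (This covers the case $Y=X$, $\pi=\mathrm{id}$, of a transitive group of biholomorphisms of $X$, and the case of a compact quotient $X=\Gamma\backslash G$ of a Lie group $G$ with a left-invariant complex structure by a discrete subgroup $\Gamma$, where $Y=G$ acts on itself by left translations.) Let $F$ be an invariant Hermitian metric on $X$, i.e. a smooth Hermitian metric, identified with its fundamental form (a positive real $(1,1)$-form), such that $\pi^*F$ is $G$-invariant. If $F$ is SKT (pluriclosed), i.e. $\partial\bar\partial F=0$, or astheno-Kähler, i.e. $\partial\bar\partial F^{n-2}=0$, then $F$ is $k$-th Gauduchon for every integer $1\le k\le n-1$, i.e. $$\partial\bar\partial F^{k}\wedge F^{n-k-1}=0\qquad (1\le k\le n-1).$$ -/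

import Mathlib

open scoped Manifold ContDiff

noncomputable section

namespace KGauduchon

/-- The model space `ℂⁿ`. -/
abbrev Cn (n : ℕ) : Type := EuclideanSpace ℂ (Fin n)

/-! ### Exterior algebra of complex-valued real-multilinear alternating forms on `ℂⁿ` -/

variable {n p q m : ℕ}

/-- The (not yet alternating) product `(α ⊗ β)(v₁, …, v_{p+q}) =
α(v₁, …, v_p) β(v_{p+1}, …, v_{p+q})`. -/
def tensorForm (α : Cn n [⋀^Fin p]→L[ℝ] ℂ) (β : Cn n [⋀^Fin q]→L[ℝ] ℂ) :
    ContinuousMultilinearMap ℝ (fun _ : Fin (p + q) => Cn n) ℂ where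
  toMultilinearMap :=
    ((LinearMap.mul' ℝ ℂ).compMultilinearMap
      (MultilinearMap.domCoprod α.toMultilinearMap β.toMultilinearMap)).domDomCongr finSumFinEquiv
  cont := by
    have h : Continuous fun v : Fin (p + q) → Cn n =>
        α (fun i => v (Fin.castAdd q i)) * β (fun i => v (Fin.natAdd p i)) := by
      fun_prop
    refine h.congr fun v => ?_
    simp [MultilinearMap.domCoprod_apply]

theorem tensorForm_apply (α : Cn n [⋀^Fin p]→L[ℝ] ℂ) (β : Cn n [⋀^Fin q]→L[ℝ] ℂ)
    (v : Fin (p + q) → Cn n) :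
    tensorForm α β v =
      α (fun i => v (Fin.castAdd q i)) * β (fun i => v (Fin.natAdd p i)) := by
  change ((LinearMap.mul' ℝ ℂ).compMultilinearMap
      (MultilinearMap.domCoprod α.toMultilinearMap β.toMultilinearMap)).domDomCongr
      finSumFinEquiv v = _
  simp [MultilinearMap.domCoprod_apply]

/-- The wedge product `α ∧ β`, see `wedge_apply` for the explicit formula. -/
def wedge (α : Cn n [⋀^Fin p]→L[ℝ] ℂ) (β : Cn n [⋀^Fin q]→L[ℝ] ℂ) :
    Cn n [⋀^Fin (p + q)]→L[ℝ] ℂ :=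
  ((p.factorial * q.factorial : ℝ)⁻¹) • ContinuousMultilinearMap.alternatization (tensorForm α β)

theorem wedge_apply (α : Cn n [⋀^Fin p]→L[ℝ] ℂ) (β : Cn n [⋀^Fin q]→L[ℝ] ℂ)
    (v : Fin (p + q) → Cn n) :
    wedge α β v = ((p.factorial * q.factorial : ℝ)⁻¹) • ∑ σ : Equiv.Perm (Fin (p + q)),
      Equiv.Perm.sign σ • (α (fun i => v (σ (Fin.castAdd q i))) *
        β (fun i => v (σ (Fin.natAdd p i)))) := by
  simp [wedge, ContinuousMultilinearMap.alternatization_apply_apply, tensorForm_apply]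

/-- The wedge power `Fᵏ = F ∧ ⋯ ∧ F` of a 2-form, with `F⁰ = 1`. -/
def wedgePow (F : Cn n [⋀^Fin 2]→L[ℝ] ℂ) : (k : ℕ) → Cn n [⋀^Fin (2 * k)]→L[ℝ] ℂ
  | 0 => ContinuousAlternatingMap.constOfIsEmpty ℝ (Cn n) (Fin 0) 1
  | k + 1 => wedge (wedgePow F k) F

/-! ### The operators `∂` and `∂̄` in holomorphic coordinates -/

/-- Multiplication by `i` on `ℂⁿ`, as a real-linear map (the complex structure `J`). -/
def mulI (n : ℕ) : Cn n →L[ℝ] Cn n :=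
  (Complex.I • ContinuousLinearMap.id ℂ (Cn n)).restrictScalars ℝ

/-- The complex-linear part `v ↦ (L v - i L(iv)) / 2` of a real-linear map. -/
def linPart (L : Cn n →L[ℝ] Cn n [⋀^Fin m]→L[ℝ] ℂ) : Cn n →L[ℝ] Cn n [⋀^Fin m]→L[ℝ] ℂ :=
  (1 / 2 : ℂ) • (L - Complex.I • L.comp (mulI n))

/-- The conjugate-linear part `v ↦ (L v + i L(iv)) / 2` of a real-linear map. -/
def antilinPart (L : Cn n →L[ℝ] Cn n [⋀^Fin m]→L[ℝ] ℂ) : Cn n →L[ℝ] Cn n [⋀^Fin m]→L[ℝ] ℂ :=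
  (1 / 2 : ℂ) • (L + Complex.I • L.comp (mulI n))

/-- The operator `∂` on complex-valued forms on (open subsets of) `ℂⁿ`. It is defined like the
exterior derivative `extDeriv`, with the derivative of the coefficients replaced by its
complex-linear part: `∂(f dz_I ∧ dz̄_J) = ∑ⱼ (∂f/∂zⱼ) dzⱼ ∧ dz_I ∧ dz̄_J`. -/
def del (α : Cn n → Cn n [⋀^Fin m]→L[ℝ] ℂ) (z : Cn n) : Cn n [⋀^Fin (m + 1)]→L[ℝ] ℂ :=
  ContinuousAlternatingMap.alternatizeUncurryFin (linPart (fderiv ℝ α z))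

/-- The operator `∂̄` on complex-valued forms on (open subsets of) `ℂⁿ`:
`∂̄(f dz_I ∧ dz̄_J) = ∑ⱼ (∂f/∂z̄ⱼ) dz̄ⱼ ∧ dz_I ∧ dz̄_J`. -/
def delbar (α : Cn n → Cn n [⋀^Fin m]→L[ℝ] ℂ) (z : Cn n) : Cn n [⋀^Fin (m + 1)]→L[ℝ] ℂ :=
  ContinuousAlternatingMap.alternatizeUncurryFin (antilinPart (fderiv ℝ α z))

/-- `d = ∂ + ∂̄`. -/
theorem del_add_delbar (α : Cn n → Cn n [⋀^Fin m]→L[ℝ] ℂ) (z : Cn n) :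
    del α z + delbar α z = extDeriv α z := by
  have h : linPart (fderiv ℝ α z) + antilinPart (fderiv ℝ α z) = fderiv ℝ α z := by
    ext v w
    simp [linPart, antilinPart]
    ring
  rw [del, delbar, ← ContinuousAlternatingMap.alternatizeUncurryFin_add, h, extDeriv]

/-! ### Hermitian metrics on complex manifolds

A complex manifold of dimension `n` is a charted space modelled on `ℂⁿ` with
`IsManifold 𝓘(ℂ, Cn n) ω X`, i.e. with biholomorphic transition maps. -/

/-- The differential of a holomorphic map at `y`, as a real-linear map of tangent spaces. (In
Mathlib the tangent space of a manifold at a point is the model space `ℂⁿ`, through the preferred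
chart at that point.) -/
def realDifferential {Y X : Type*}
    [TopologicalSpace Y] [ChartedSpace (Cn n) Y] [TopologicalSpace X] [ChartedSpace (Cn n) X]
    (φ : Y → X) (y : Y) : Cn n →L[ℝ] Cn n :=
  let L : Cn n →L[ℂ] Cn n := mfderiv 𝓘(ℂ, Cn n) 𝓘(ℂ, Cn n) φ y
  L.restrictScalars ℝ

/-- The pullback of a field of real `m`-forms by a holomorphic map. -/
def pullbackForm {Y X : Type*}
    [TopologicalSpace Y] [ChartedSpace (Cn n) Y] [TopologicalSpace X] [ChartedSpace (Cn n) X]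
    (φ : Y → X) (α : X → Cn n [⋀^Fin m]→L[ℝ] ℝ) (y : Y) : Cn n [⋀^Fin m]→L[ℝ] ℝ :=
  (α (φ y)).compContinuousLinearMap (realDifferential φ y)

/-- A (smooth) Hermitian metric on a complex manifold `X` of dimension `n`, given by its
fundamental form `F`: a smooth real 2-form of type `(1,1)` (i.e. `J`-invariant) which is positive.
The corresponding Riemannian metric is `g(v, w) = F(v, Jw)`. -/
structure HermitianMetric (n : ℕ) (X : Type*) [TopologicalSpace X] [ChartedSpace (Cn n) X] where
  /-- the fundamental form, at each point an alternating form on the tangent space -/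
  form : X → Cn n [⋀^Fin 2]→L[ℝ] ℝ
  type_one_one : ∀ (x : X) (v w : Cn n),
    form x ![Complex.I • v, Complex.I • w] = form x ![v, w]
  pos : ∀ (x : X) (v : Cn n), v ≠ 0 → 0 < form x ![v, Complex.I • v]
  smooth : ∀ e ∈ atlas (Cn n) X, ContDiffOn ℝ ∞ (pullbackForm (n := n) e.symm form) e.target

variable {X : Type*} [TopologicalSpace X] [ChartedSpace (Cn n) X]

/-- The fundamental form `F`, read in the chart `e`, as a complex-valued form on `e.target ⊆ ℂⁿ`. -/
def HermitianMetric.inChart (F : HermitianMetric n X) (e : OpenPartialHomeomorph X (Cn n))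
    (z : Cn n) : Cn n [⋀^Fin 2]→L[ℝ] ℂ :=
  Complex.ofRealCLM.compContinuousAlternatingMap (pullbackForm (n := n) e.symm F.form z)

/-- SKT (pluriclosed) metrics: `∂∂̄F = 0`. -/
def HermitianMetric.IsSKT (F : HermitianMetric n X) : Prop :=
  ∀ e ∈ atlas (Cn n) X, ∀ z ∈ e.target, del (delbar (F.inChart e)) z = 0

/-- Astheno-Kähler metrics: `∂∂̄F^{n-2} = 0`. -/
def HermitianMetric.IsAsthenoKahler (F : HermitianMetric n X) : Prop :=
  ∀ e ∈ atlas (Cn n) X, ∀ z ∈ e.target,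
    del (delbar fun z' => wedgePow (F.inChart e z') (n - 2)) z = 0

/-- `k`-th Gauduchon metrics (`1 ≤ k ≤ n - 1`): `∂∂̄Fᵏ ∧ F^{n-k-1} = 0`. -/
def HermitianMetric.IsGauduchon (F : HermitianMetric n X) (k : ℕ) : Prop :=
  ∀ e ∈ atlas (Cn n) X, ∀ z ∈ e.target,
    wedge (del (delbar fun z' => wedgePow (F.inChart e z') k) z)
      (wedgePow (F.inChart e z) (n - k - 1)) = 0

/-- `X` is homogeneous, presented by `π : Y → X`: `Y` is a complex manifold on which the group `G`
acts transitively by biholomorphisms, and `π` is a surjective local biholomorphism. With `Y = X`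
and `π = id` this is a transitive group of biholomorphisms of `X`; with `Y = G` a Lie group with a
left-invariant complex structure and `π : G → Γ \ G` the projection, it is a compact quotient of a
Lie group by a lattice with an invariant complex structure, e.g. a complex nilmanifold. -/
structure IsHomogeneous (n : ℕ) (G : Type*) {Y X : Type*} [Group G] [MulAction G Y]
    [TopologicalSpace Y] [ChartedSpace (Cn n) Y] [TopologicalSpace X] [ChartedSpace (Cn n) X]
    (π : Y → X) : Prop where
  transitive : MulAction.IsPretransitive G Y
  holomorphic_smul : ∀ g : G, ContMDiff 𝓘(ℂ, Cn n) 𝓘(ℂ, Cn n) ω (fun y : Y => g • y)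
  isLocalDiffeomorph : IsLocalDiffeomorph 𝓘(ℂ, Cn n) 𝓘(ℂ, Cn n) ω π
  surjective : Function.Surjective π

/-- The metric `F` on `X` is invariant: its pullback to `Y` is preserved by the action of `G`. -/
def HermitianMetric.IsInvariant (F : HermitianMetric n X) (G : Type*) {Y : Type*} [Group G]
    [MulAction G Y] [TopologicalSpace Y] [ChartedSpace (Cn n) Y] (π : Y → X) : Prop :=
  ∀ g : G, pullbackForm (n := n) (fun y : Y => g • y) (pullbackForm (n := n) π F.form) =
    pullbackForm (n := n) π F.form

end KGauduchon

end

noncomputable section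

namespace KGauduchon

open MeasureTheory

variable {n p q m N : ℕ}

/-! ### Alternating forms as elements of an exterior algebra -/

/-- The complex exterior algebra on `N` generators. -/
abbrev Grassmann (N : ℕ) : Type := ExteriorAlgebra ℂ (Fin N → ℂ)

/-- The `j`-th generator of the exterior algebra. -/
abbrev gen {N : ℕ} (j : Fin N) : Fin N → ℂ := Pi.single j 1

instance (N : ℕ) : Module.Finite ℂ (Grassmann N) :=
  Module.Finite.of_basis (Pi.basisFun ℂ (Fin N)).ExteriorAlgebra

instance (N : ℕ) : NormedAddCommGroup (Grassmann N) :=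
  NormedAddCommGroup.induced (Grassmann N) (Finset (Fin N) → ℂ)
    (Pi.basisFun ℂ (Fin N)).ExteriorAlgebra.equivFun
    (Pi.basisFun ℂ (Fin N)).ExteriorAlgebra.equivFun.injective

instance (N : ℕ) : NormedSpace ℂ (Grassmann N) :=
  NormedSpace.induced ℂ (Grassmann N) (Finset (Fin N) → ℂ)
    (Pi.basisFun ℂ (Fin N)).ExteriorAlgebra.equivFun

/-- The element of the exterior algebra representing an alternating form in the real basis `b`. -/
def toGrassmann (b : Module.Basis (Fin N) ℝ (Cn n)) :
    (Cn n [⋀^Fin p]→L[ℝ] ℂ) →ₗ[ℂ] Grassmann N where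
  toFun α := ((p.factorial : ℂ)⁻¹) • ∑ I : Fin p → Fin N,
    α (fun i => b (I i)) • ExteriorAlgebra.ιMulti ℂ p (fun i => gen (I i))
  map_add' α β := by simp [add_smul, Finset.sum_add_distrib]
  map_smul' c α := by
    simp only [ContinuousAlternatingMap.smul_apply, smul_eq_mul, mul_smul, RingHom.id_apply,
      ← Finset.smul_sum]
    rw [smul_comm]

theorem toGrassmann_apply (b : Module.Basis (Fin N) ℝ (Cn n)) (α : Cn n [⋀^Fin p]→L[ℝ] ℂ) :
    toGrassmann b α = ((p.factorial : ℂ)⁻¹) • ∑ I : Fin p → Fin N,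
      α (fun i => b (I i)) • ExteriorAlgebra.ιMulti ℂ p (fun i => gen (I i)) := rfl

theorem toGrassmann_injective (b : Module.Basis (Fin N) ℝ (Cn n)) :
    Function.Injective (toGrassmann (p := p) b) := by
  have hdet (K : Fin p → Fin N) (α : Cn n [⋀^Fin p]→L[ℝ] ℂ) :
      ExteriorAlgebra.liftAlternating (R := ℂ) (N := ℂ)
        (Pi.single (M := fun i => (Fin N → ℂ) [⋀^Fin i]→ₗ[ℂ] ℂ) p
          (Matrix.detRowAlternating.compLinearMap (LinearMap.funLeft ℂ ℂ K)))
        (toGrassmann b α) = α (fun i => b (K i)) := by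
    have hsum : ∑ I : Fin p → Fin N, α (fun i => b (I i)) *
        Matrix.det (Matrix.of fun i j => gen (I i) (K j)) = p.factorial * α (fun i => b (K i)) := by
      simp only [Matrix.det_apply, Matrix.of_apply, Finset.mul_sum]
      rw [Finset.sum_comm]
      have hσ (σ : Equiv.Perm (Fin p)) : ∑ I : Fin p → Fin N, α (fun i => b (I i)) *
          (Equiv.Perm.sign σ • ∏ i, gen (I (σ i)) (K i)) = α (fun i => b (K i)) := by
        rw [Finset.sum_eq_single (K ∘ σ.symm)]
        · have h1 : α (fun i => b ((K ∘ σ.symm) i)) =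
              Equiv.Perm.sign σ.symm • α (fun i => b (K i)) :=
            α.toAlternatingMap.map_perm (fun i => b (K i)) σ.symm
          rw [h1]
          simp only [gen, Function.comp_apply, Equiv.symm_apply_apply, Pi.single_eq_same,
            Finset.prod_const_one, Equiv.Perm.sign_symm]
          rcases Int.units_eq_one_or (Equiv.Perm.sign σ) with h | h <;> simp [h]
        · intro I _ hI
          obtain ⟨i, hi⟩ : ∃ i, K i ≠ I (σ i) := by
            by_contra! hcon
            exact hI (funext fun i => by simp [hcon])
          have : ∏ i, (gen (I (σ i)) (K i) : ℂ) = 0 :=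
            Finset.prod_eq_zero (Finset.mem_univ i) (by simp [gen, hi])
          rw [this]; simp
        · simp
      simp [hσ, Fintype.card_perm]
    rw [toGrassmann_apply, map_smul, map_sum]
    simp only [map_smul, ExteriorAlgebra.liftAlternating_apply_ιMulti, Pi.single_eq_same]
    have : ∀ I : Fin p → Fin N, (Matrix.detRowAlternating.compLinearMap
        (LinearMap.funLeft ℂ ℂ K)) (fun i => gen (I i)) =
        Matrix.det (Matrix.of fun i j => (gen (I i) (K j) : ℂ)) := fun I => rfl
    simp only [this, smul_eq_mul, hsum]
    rw [inv_mul_cancel_left₀]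
    exact_mod_cast p.factorial_ne_zero
  intro α β h
  apply ContinuousAlternatingMap.toAlternatingMap_injective
  refine Module.Basis.ext_alternating b fun K _ => ?_
  have := hdet K α
  rw [h, hdet K β] at this
  exact this.symm

theorem toGrassmann_wedge (b : Module.Basis (Fin N) ℝ (Cn n)) (α : Cn n [⋀^Fin p]→L[ℝ] ℂ)
    (β : Cn n [⋀^Fin q]→L[ℝ] ℂ) :
    toGrassmann b (wedge α β) = toGrassmann b α * toGrassmann b β := by
  have hmul (I : Fin (p + q) → Fin N) :
      ExteriorAlgebra.ιMulti ℂ (p + q) (fun i => gen (I i)) =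
        ExteriorAlgebra.ιMulti ℂ p (fun i => gen (I (Fin.castAdd q i))) *
          ExteriorAlgebra.ιMulti ℂ q (fun i => gen (I (Fin.natAdd p i))) := by
    simp only [ExteriorAlgebra.ιMulti_apply]
    rw [List.ofFn_add, List.prod_append]
    rfl
  have hσ (σ : Equiv.Perm (Fin (p + q))) :
      ∑ I : Fin (p + q) → Fin N, (Equiv.Perm.sign σ •
        (α (fun i => b (I (σ (Fin.castAdd q i)))) * β (fun i => b (I (σ (Fin.natAdd p i)))))) •
          ExteriorAlgebra.ιMulti ℂ (p + q) (fun i => gen (I i)) =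
      ∑ I : Fin (p + q) → Fin N,
        (α (fun i => b (I (Fin.castAdd q i))) * β (fun i => b (I (Fin.natAdd p i)))) •
          ExteriorAlgebra.ιMulti ℂ (p + q) (fun i => gen (I i)) := by
    refine Fintype.sum_equiv (Equiv.arrowCongr σ.symm (Equiv.refl _)) _ _ fun I => ?_
    have h1 : ExteriorAlgebra.ιMulti ℂ (p + q)
        (fun i => gen ((Equiv.arrowCongr σ.symm (Equiv.refl _)) I i)) =
        Equiv.Perm.sign σ • ExteriorAlgebra.ιMulti ℂ (p + q) (fun i => gen (I i)) :=
      (ExteriorAlgebra.ιMulti ℂ (p + q)).map_perm (fun i => gen (I i)) σ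
    rw [h1]
    simp only [Equiv.arrowCongr_apply, Equiv.symm_symm, Equiv.coe_refl, Function.comp_apply, id]
    rcases Int.units_eq_one_or (Equiv.Perm.sign σ) with h | h <;> simp [h]
  have hsplit : ∑ I : Fin (p + q) → Fin N,
        (α (fun i => b (I (Fin.castAdd q i))) * β (fun i => b (I (Fin.natAdd p i)))) •
          ExteriorAlgebra.ιMulti ℂ (p + q) (fun i => gen (I i)) =
      ∑ I : Fin p → Fin N, ∑ J : Fin q → Fin N,
        (α (fun i => b (I i)) * β (fun i => b (J i))) •
          (ExteriorAlgebra.ιMulti ℂ p (fun i => gen (I i)) *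
            ExteriorAlgebra.ιMulti ℂ q (fun i => gen (J i))) := by
    rw [← Fintype.sum_prod_type']
    refine Fintype.sum_equiv (Fin.appendEquiv p q).symm _ _ fun I => ?_
    rw [hmul]
    rfl
  have hw (I : Fin (p + q) → Fin N) : wedge α β (fun i => b (I i)) =
      ((p.factorial : ℂ)⁻¹ * (q.factorial : ℂ)⁻¹) * ∑ σ : Equiv.Perm (Fin (p + q)),
        Equiv.Perm.sign σ • (α (fun i => b (I (σ (Fin.castAdd q i)))) *
          β (fun i => b (I (σ (Fin.natAdd p i))))) := by
    rw [wedge_apply, Complex.real_smul]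
    push_cast
    rw [mul_inv]
  rw [toGrassmann_apply]
  simp only [hw, mul_smul _ (Finset.sum _ _) _, ← Finset.smul_sum, Finset.sum_smul]
  rw [Finset.sum_comm]
  simp only [hσ]
  rw [Finset.sum_const, Finset.card_univ, Fintype.card_perm, Fintype.card_fin, hsplit,
    toGrassmann_apply, toGrassmann_apply, smul_mul_smul_comm, Finset.sum_mul_sum]
  simp only [smul_mul_smul_comm]
  rw [← Nat.cast_smul_eq_nsmul ℂ, smul_smul, smul_smul]
  congr 1
  have : ((p + q).factorial : ℂ) ≠ 0 := by exact_mod_cast (p + q).factorial_ne_zero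
  field_simp

theorem toGrassmann_alternatizeUncurryFin (b : Module.Basis (Fin N) ℝ (Cn n))
    (L : Cn n →L[ℝ] Cn n [⋀^Fin p]→L[ℝ] ℂ) :
    toGrassmann b (ContinuousAlternatingMap.alternatizeUncurryFin L) =
      ∑ j, ExteriorAlgebra.ι ℂ (gen j) * toGrassmann b (L (b j)) := by
  have hterm (i : Fin (p + 1)) : ∑ I : Fin (p + 1) → Fin N,
      ((-1 : ℤ) ^ (i : ℕ) • L (b (I i)) (i.removeNth fun i => b (I i))) •
        ExteriorAlgebra.ιMulti ℂ (p + 1) (fun i => gen (I i)) =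
      ∑ j : Fin N, ∑ I : Fin p → Fin N, L (b j) (fun i => b (I i)) •
        (ExteriorAlgebra.ι ℂ (gen j) * ExteriorAlgebra.ιMulti ℂ p (fun i => gen (I i))) := by
    rw [← Fintype.sum_prod_type']
    refine Fintype.sum_equiv (Fin.insertNthEquiv (fun _ => Fin N) i).symm _ _ fun I => ?_
    have h1 : (fun k => (gen (I k) : Fin N → ℂ)) =
        i.insertNth (gen (I i)) (fun k => gen (I (i.succAbove k))) := by
      rw [Fin.eq_insertNth_iff]
      exact ⟨rfl, rfl⟩
    rw [h1, AlternatingMap.map_insertNth, ExteriorAlgebra.ιMulti_succ_apply]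
    simp only [Fin.insertNthEquiv_symm_apply, Matrix.cons_val_zero]
    rcases neg_one_pow_eq_or ℤ (i : ℕ) with h | h <;> simp [h] <;> rfl
  rw [toGrassmann_apply]
  simp only [ContinuousAlternatingMap.alternatizeUncurryFin_apply, Finset.sum_smul]
  rw [Finset.sum_comm]
  simp only [hterm]
  rw [Finset.sum_const, Finset.card_univ, Fintype.card_fin]
  simp only [toGrassmann_apply, mul_smul_comm, ← Finset.smul_sum, Finset.mul_sum]
  rw [← Nat.cast_smul_eq_nsmul ℂ, smul_smul]
  congr 1
  have : (p.factorial : ℂ) ≠ 0 := by exact_mod_cast p.factorial_ne_zero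
  have : ((p : ℂ) + 1) ≠ 0 := by exact_mod_cast p.succ_ne_zero
  rw [Nat.factorial_succ]
  push_cast
  field_simp

theorem toGrassmann_wedgePow (b : Module.Basis (Fin N) ℝ (Cn n)) (F : Cn n [⋀^Fin 2]→L[ℝ] ℂ)
    (k : ℕ) : toGrassmann b (wedgePow F k) = toGrassmann b F ^ k := by
  induction k with
  | zero => simp [toGrassmann_apply, wedgePow]
  | succ k ih => rw [pow_succ, ← ih, ← toGrassmann_wedge]; rfl

theorem commute_of_forall_ι {x : Grassmann N}
    (h : ∀ v, Commute x (ExteriorAlgebra.ι ℂ v)) (y : Grassmann N) : Commute x y := by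
  induction y using ExteriorAlgebra.induction with
  | algebraMap r => exact (Algebra.commutes r x).symm
  | ι v => exact h v
  | mul a c ha hc => exact ha.mul_right hc
  | add a c ha hc => exact ha.add_right hc

theorem commute_toGrassmann_two (b : Module.Basis (Fin N) ℝ (Cn n))
    (F : Cn n [⋀^Fin 2]→L[ℝ] ℂ) (y : Grassmann N) : Commute (toGrassmann b F) y := by
  refine commute_of_forall_ι (fun v => ?_) y
  rw [toGrassmann_apply]
  refine Commute.smul_left (Finset.sum_induction _ (Commute · (ExteriorAlgebra.ι ℂ v))
    (fun _ _ => Commute.add_left) (Commute.zero_left _) fun I _ => Commute.smul_left ?_ _) _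
  have hanti (u w : Fin N → ℂ) : ExteriorAlgebra.ι ℂ u * ExteriorAlgebra.ι ℂ w =
      -(ExteriorAlgebra.ι ℂ w * ExteriorAlgebra.ι ℂ u) :=
    eq_neg_of_add_eq_zero_left (ExteriorAlgebra.ι_add_mul_swap u w)
  simp only [ExteriorAlgebra.ιMulti_apply, List.ofFn_succ, List.ofFn_zero, List.prod_cons,
    List.prod_nil, mul_one, Commute, SemiconjBy]
  rw [mul_assoc, hanti _ v, mul_neg, ← mul_assoc, hanti _ v, neg_mul, neg_neg, mul_assoc]

/-! ### Calculus of the operators `∂` and `∂̄` -/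

section Calculus

theorem wedge_norm_le (α : Cn n [⋀^Fin p]→L[ℝ] ℂ) (β : Cn n [⋀^Fin q]→L[ℝ] ℂ) :
    ‖wedge α β‖ ≤ (((p.factorial * q.factorial : ℝ)⁻¹) * (p + q).factorial) * ‖α‖ * ‖β‖ := by
  refine ContinuousAlternatingMap.opNorm_le_bound _ (by positivity) fun v => ?_
  rw [wedge_apply, norm_smul, norm_inv, Real.norm_of_nonneg (by positivity)]
  have hterm (σ : Equiv.Perm (Fin (p + q))) :
      ‖Equiv.Perm.sign σ • (α (fun i => v (σ (Fin.castAdd q i))) *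
        β (fun i => v (σ (Fin.natAdd p i))))‖ ≤ ‖α‖ * ‖β‖ * ∏ i, ‖v i‖ := by
    have h1 := α.le_opNorm (fun i => v (σ (Fin.castAdd q i)))
    have h2 := β.le_opNorm (fun i => v (σ (Fin.natAdd p i)))
    have h3 : ∏ i, ‖v i‖ = (∏ i, ‖v (σ (Fin.castAdd q i))‖) * ∏ i, ‖v (σ (Fin.natAdd p i))‖ := by
      rw [← Equiv.prod_comp σ, Fin.prod_univ_add]
    have h4 : ‖Equiv.Perm.sign σ • (α (fun i => v (σ (Fin.castAdd q i))) *
        β (fun i => v (σ (Fin.natAdd p i))))‖ = ‖α (fun i => v (σ (Fin.castAdd q i)))‖ *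
        ‖β (fun i => v (σ (Fin.natAdd p i)))‖ := by
      rcases Int.units_eq_one_or (Equiv.Perm.sign σ) with h | h <;> simp [h]
    rw [h4, h3]
    calc _ ≤ _ := mul_le_mul h1 h2 (norm_nonneg _) (by positivity)
      _ = _ := by ring
  calc _ ≤ (p.factorial * q.factorial : ℝ)⁻¹ *
        ((Fintype.card (Equiv.Perm (Fin (p + q)))) • (‖α‖ * ‖β‖ * ∏ i, ‖v i‖)) := by
        gcongr
        exact norm_sum_le_of_le _ (fun σ _ => hterm σ) |>.trans_eq (by simp)
    _ = _ := by
        rw [Fintype.card_perm, Fintype.card_fin, nsmul_eq_mul]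
        ring

/-- The wedge product as a continuous bilinear map. -/
def wedgeCLM (n p q : ℕ) : (Cn n [⋀^Fin p]→L[ℝ] ℂ) →L[ℝ] (Cn n [⋀^Fin q]→L[ℝ] ℂ) →L[ℝ]
    (Cn n [⋀^Fin (p + q)]→L[ℝ] ℂ) :=
  LinearMap.mkContinuous₂ (LinearMap.mk₂ ℝ wedge
    (fun α α' β => by
      ext v; simp [wedge_apply, add_mul, Finset.sum_add_distrib])
    (fun c α β => by
      ext v
      simp only [wedge_apply, ContinuousAlternatingMap.smul_apply, smul_mul_assoc,
        smul_comm _ c, ← Finset.smul_sum])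
    (fun α β β' => by
      ext v; simp [wedge_apply, mul_add, Finset.sum_add_distrib])
    (fun c α β => by
      ext v
      simp only [wedge_apply, ContinuousAlternatingMap.smul_apply, mul_smul_comm,
        smul_comm _ c, ← Finset.smul_sum]))
    _ wedge_norm_le

theorem contDiffAt_wedgePow {F : Cn n → Cn n [⋀^Fin 2]→L[ℝ] ℂ} {z : Cn n} {r : WithTop ℕ∞}
    (hF : ContDiffAt ℝ r F z) (k : ℕ) : ContDiffAt ℝ r (fun z' => wedgePow (F z') k) z := by
  induction k with
  | zero => exact contDiffAt_const
  | succ k ih =>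
    exact ((wedgeCLM n (2 * k) 2).contDiff.contDiffAt.comp z ih).clm_apply hF

/-- The common form of the operators `∂` (for `s = -i`) and `∂̄` (for `s = i`). -/
def dolbeault (s : ℂ) (α : Cn n → Cn n [⋀^Fin m]→L[ℝ] ℂ) (z : Cn n) :
    Cn n [⋀^Fin (m + 1)]→L[ℝ] ℂ :=
  ContinuousAlternatingMap.alternatizeUncurryFin
    ((1 / 2 : ℂ) • (fderiv ℝ α z + s • (fderiv ℝ α z).comp (mulI n)))

theorem del_eq_dolbeault (α : Cn n → Cn n [⋀^Fin m]→L[ℝ] ℂ) :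
    del α = dolbeault (-Complex.I) α := by
  funext z
  rw [del, linPart, dolbeault]
  congr 2
  ext v w
  simp [sub_eq_add_neg]

theorem delbar_eq_dolbeault (α : Cn n → Cn n [⋀^Fin m]→L[ℝ] ℂ) :
    delbar α = dolbeault Complex.I α := rfl

/-- `dolbeault` as a continuous linear function of the first derivative of the form. -/
def dolbeaultCLM (n m : ℕ) (s : ℂ) :
    (Cn n →L[ℝ] Cn n [⋀^Fin m]→L[ℝ] ℂ) →L[ℝ] Cn n [⋀^Fin (m + 1)]→L[ℝ] ℂ :=
  (ContinuousAlternatingMap.alternatizeUncurryFinCLM ℝ (Cn n) ℂ).comp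
    ((1 / 2 : ℂ) • (ContinuousLinearMap.id ℝ _ +
      s • (ContinuousLinearMap.compL ℝ (Cn n) (Cn n) (Cn n [⋀^Fin m]→L[ℝ] ℂ)).flip (mulI n)))

theorem dolbeaultCLM_fderiv (s : ℂ) (α : Cn n → Cn n [⋀^Fin m]→L[ℝ] ℂ) (z : Cn n) :
    dolbeaultCLM n m s (fderiv ℝ α z) = dolbeault s α z := rfl

theorem dolbeault_apply (s : ℂ) (α : Cn n → Cn n [⋀^Fin m]→L[ℝ] ℂ) (z : Cn n)
    (v : Fin (m + 1) → Cn n) :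
    dolbeault s α z v = ∑ i : Fin (m + 1), ((-1 : ℂ) ^ (i : ℕ) * (1 / 2)) •
      (fderiv ℝ α z (v i) (i.removeNth v) +
        s • fderiv ℝ α z (Complex.I • v i) (i.removeNth v)) := by
  rw [dolbeault, ContinuousAlternatingMap.alternatizeUncurryFin_apply]
  refine Finset.sum_congr rfl fun i _ => ?_
  rw [mul_smul, zsmul_eq_mul, Int.cast_pow, Int.cast_neg, Int.cast_one, smul_eq_mul]
  rfl

theorem contDiffAt_dolbeault {α : Cn n → Cn n [⋀^Fin m]→L[ℝ] ℂ} {z : Cn n}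
    {r r' : WithTop ℕ∞} (s : ℂ) (hα : ContDiffAt ℝ r' α z) (hr : r + 1 ≤ r') :
    ContDiffAt ℝ r (dolbeault s α) z :=
  have h : ContDiff ℝ r (dolbeaultCLM n m s) := by fun_prop
  h.contDiffAt.comp z (hα.fderiv_right hr)

theorem dolbeault_congr {α β : Cn n → Cn n [⋀^Fin m]→L[ℝ] ℂ} {z : Cn n} (s : ℂ)
    (h : α =ᶠ[nhds z] β) : dolbeault s α z = dolbeault s β z := by
  rw [dolbeault, dolbeault, h.fderiv_eq]

/-- The operators `∂` and `∂̄` on functions with values in the exterior algebra. -/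
def gDolbeault (b : Module.Basis (Fin N) ℝ (Cn n)) (s : ℂ) (f : Cn n → Grassmann N) (z : Cn n) :
    Grassmann N :=
  ∑ j, ExteriorAlgebra.ι ℂ (gen j) *
    ((1 / 2 : ℂ) • (fderiv ℝ f z (b j) + s • fderiv ℝ f z (Complex.I • b j)))

variable (b : Module.Basis (Fin N) ℝ (Cn n))

/-- `toGrassmann` as a continuous linear map. -/
def toGrassmannCLM : (Cn n [⋀^Fin p]→L[ℝ] ℂ) →L[ℝ] Grassmann N where
  toLinearMap := (toGrassmann b).restrictScalars ℝ
  cont := by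
    change Continuous fun α : Cn n [⋀^Fin p]→L[ℝ] ℂ => toGrassmann b α
    simp only [toGrassmann_apply]
    have (v : Fin p → Cn n) : Continuous fun α : Cn n [⋀^Fin p]→L[ℝ] ℂ => α v :=
      (ContinuousAlternatingMap.apply ℝ (Cn n) ℂ v).continuous
    fun_prop

theorem fderiv_toGrassmann {α : Cn n → Cn n [⋀^Fin m]→L[ℝ] ℂ} {z : Cn n}
    (hα : DifferentiableAt ℝ α z) (v : Cn n) :
    fderiv ℝ (fun z' => toGrassmann b (α z')) z v = toGrassmann b (fderiv ℝ α z v) := by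
  have := ((toGrassmannCLM (p := m) b).hasFDerivAt.comp z hα.hasFDerivAt).fderiv
  change fderiv ℝ (fun z' => toGrassmann b (α z')) z = _ at this
  rw [this]; rfl

theorem toGrassmann_dolbeault (s : ℂ) {α : Cn n → Cn n [⋀^Fin m]→L[ℝ] ℂ} {z : Cn n}
    (hα : DifferentiableAt ℝ α z) :
    toGrassmann b (dolbeault s α z) = gDolbeault b s (fun z' => toGrassmann b (α z')) z := by
  rw [dolbeault, toGrassmann_alternatizeUncurryFin, gDolbeault]
  refine Finset.sum_congr rfl fun j _ => ?_
  rw [fderiv_toGrassmann b hα, fderiv_toGrassmann b hα, ← map_smul, ← map_add, ← map_smul]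
  rfl

/-- The multiplication of the exterior algebra as a continuous bilinear map. -/
def grassmannMul (N : ℕ) : Grassmann N →L[ℝ] Grassmann N →L[ℝ] Grassmann N :=
  haveI : FiniteDimensional ℝ (Grassmann N) := Module.Finite.trans ℂ _
  LinearMap.toContinuousBilinearMap (LinearMap.mul ℝ (Grassmann N))

theorem hasFDerivAt_grassmann_mul {f g : Cn n → Grassmann N} {z : Cn n}
    (hf : DifferentiableAt ℝ f z) (hg : DifferentiableAt ℝ g z) :
    DifferentiableAt ℝ (fun z' => f z' * g z') z ∧
    ∀ v, fderiv ℝ (fun z' => f z' * g z') z v = fderiv ℝ f z v * g z + f z * fderiv ℝ g z v := by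
  have h := (grassmannMul N).hasFDerivAt_of_bilinear hf.hasFDerivAt hg.hasFDerivAt
  refine ⟨h.differentiableAt, fun v => ?_⟩
  have := h.fderiv
  change fderiv ℝ (fun z' => f z' * g z') z = _ at this
  rw [this, add_comm]
  rfl

theorem gDolbeault_mul (s : ℂ) {f g : Cn n → Grassmann N} {z : Cn n}
    (hf : DifferentiableAt ℝ f z) (hg : DifferentiableAt ℝ g z) (hc : ∀ y, Commute (f z) y) :
    gDolbeault b s (fun z' => f z' * g z') z =
      gDolbeault b s f z * g z + f z * gDolbeault b s g z := by
  simp only [gDolbeault, (hasFDerivAt_grassmann_mul hf hg).2, Finset.sum_mul, Finset.mul_sum,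
    ← Finset.sum_add_distrib]
  refine Finset.sum_congr rfl fun j _ => ?_
  have (x y : Grassmann N) : f z * (x * y) = x * (f z * y) := by
    rw [← mul_assoc, (hc x).eq, mul_assoc]
  simp only [this, smul_add, mul_add, smul_mul_assoc, mul_smul_comm, add_mul, mul_assoc]
  abel

theorem gDolbeault_const_smul (s c : ℂ) {f : Cn n → Grassmann N} {z : Cn n}
    (hf : DifferentiableAt ℝ f z) :
    gDolbeault b s (fun z' => c • f z') z = c • gDolbeault b s f z := by
  simp only [gDolbeault, fderiv_fun_const_smul hf, Finset.smul_sum]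
  refine Finset.sum_congr rfl fun j _ => ?_
  simp only [_root_.smul_apply, mul_smul_comm, smul_comm _ c, ← smul_add]

theorem gDolbeault_pow (s : ℂ) {f : Cn n → Grassmann N} {z : Cn n}
    (hf : DifferentiableAt ℝ f z) (hc : ∀ y, Commute (f z) y) (k : ℕ) :
    DifferentiableAt ℝ (fun z' => f z' ^ k) z ∧
    gDolbeault b s (fun z' => f z' ^ k) z = (k : ℂ) • (f z ^ (k - 1) * gDolbeault b s f z) := by
  induction k with
  | zero => simp [gDolbeault]
  | succ k ih =>
    simp only [pow_succ']
    refine ⟨(hasFDerivAt_grassmann_mul hf ih.1).1, ?_⟩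
    rw [gDolbeault_mul b s hf ih.1 hc, ih.2]
    have h1 : gDolbeault b s f z * f z ^ k = f z ^ k * gDolbeault b s f z :=
      ((hc _).pow_left k).eq.symm
    rw [h1, mul_smul_comm, ← mul_assoc, ← pow_succ']
    cases k with
    | zero => simp
    | succ k => simp [add_smul, add_comm]

theorem toGrassmann_dolbeault_dolbeault_wedgePow (s t : ℂ)
    {F : Cn n → Cn n [⋀^Fin 2]→L[ℝ] ℂ} {z : Cn n} (hF : ContDiffAt ℝ 2 F z) (k : ℕ) :
    toGrassmann b (dolbeault t (dolbeault s fun z' => wedgePow (F z') k) z) =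
      (k : ℂ) • (toGrassmann b (F z) ^ (k - 1) * toGrassmann b (dolbeault t (dolbeault s F) z)) +
      ((k * (k - 1 : ℕ) : ℕ) : ℂ) • (toGrassmann b (F z) ^ (k - 2) *
        (toGrassmann b (dolbeault t F z) * toGrassmann b (dolbeault s F z))) := by
  have hd : ∀ᶠ z' in nhds z, DifferentiableAt ℝ F z' :=
    (hF.eventually (by simp)).mono fun z' h => h.differentiableAt (by simp)
  have hc (z' : Cn n) := commute_toGrassmann_two b (F z')
  have hf {z'} (h : DifferentiableAt ℝ F z') :
      DifferentiableAt ℝ (fun z'' => toGrassmann b (F z'')) z' :=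
    (toGrassmannCLM b).differentiableAt.comp z' h
  have hsF : DifferentiableAt ℝ (dolbeault s F) z :=
    (contDiffAt_dolbeault (r := 1) s hF (by norm_num)).differentiableAt (by simp)
  have hsP : DifferentiableAt ℝ (dolbeault s fun z' => wedgePow (F z') k) z :=
    (contDiffAt_dolbeault (r := 1) s (contDiffAt_wedgePow hF k) (by norm_num)).differentiableAt
      (by simp)
  have hg : DifferentiableAt ℝ (fun z' => toGrassmann b (dolbeault s F z')) z :=
    (toGrassmannCLM b).differentiableAt.comp z hsF
  have hz := hd.self_of_nhds
  have hev : (fun z' => toGrassmann b (dolbeault s (fun z' => wedgePow (F z') k) z')) =ᶠ[nhds z]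
      fun z' => (k : ℂ) • (toGrassmann b (F z') ^ (k - 1) *
        toGrassmann b (dolbeault s F z')) := by
    filter_upwards [hF.eventually (by simp)] with z' hz'
    have hz1 := hz'.differentiableAt (by simp)
    rw [toGrassmann_dolbeault b s
      ((contDiffAt_wedgePow hz' k).differentiableAt (by simp))]
    simp only [toGrassmann_wedgePow]
    rw [(gDolbeault_pow b s (hf hz1) (hc z') k).2, toGrassmann_dolbeault b s hz1]
  have hpow := gDolbeault_pow b t (hf hz) (hc z) (k - 1)
  rw [toGrassmann_dolbeault b t hsP, gDolbeault, hev.fderiv_eq, ← gDolbeault,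
    gDolbeault_const_smul b t _ (hasFDerivAt_grassmann_mul hpow.1 hg).1,
    gDolbeault_mul b t hpow.1 hg (fun y => (hc z y).pow_left _), hpow.2,
    toGrassmann_dolbeault b t hsF, toGrassmann_dolbeault b t hz, Nat.sub_sub]
  simp only [smul_add, smul_mul_assoc, smul_smul, mul_assoc]
  push_cast
  rw [add_comm]

/-- On a form `F` for which `∂∂̄F^{n-1} = 0`, the SKT and the astheno-Kähler conditions each imply
all `k`-th Gauduchon conditions. -/
theorem gauduchon_of_balance {s t : ℂ} {F : Cn n → Cn n [⋀^Fin 2]→L[ℝ] ℂ} {z : Cn n}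
    (b : Module.Basis (Fin N) ℝ (Cn n))
    (hn : 3 ≤ n) (hF : ContDiffAt ℝ 2 F z)
    (h0 : dolbeault t (dolbeault s fun z' => wedgePow (F z') (n - 1)) z = 0)
    (h : dolbeault t (dolbeault s F) z = 0 ∨
      dolbeault t (dolbeault s fun z' => wedgePow (F z') (n - 2)) z = 0)
    (k : ℕ) (hk : 1 ≤ k) (hkn : k ≤ n - 1) :
    wedge (dolbeault t (dolbeault s fun z' => wedgePow (F z') k) z)
      (wedgePow (F z) (n - k - 1)) = 0 := by
  obtain ⟨l, rfl⟩ : ∃ l, n = l + 3 := ⟨n - 3, by omega⟩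
  have hc := commute_toGrassmann_two b (F z)
  set f := toGrassmann b (F z) with hfdef
  set A := f ^ (l + 1) * toGrassmann b (dolbeault t (dolbeault s F) z) with hA
  set β := toGrassmann b (dolbeault t F z) * toGrassmann b (dolbeault s F z) with hβ
  set B := f ^ l * β with hB
  have h0' := toGrassmann_dolbeault_dolbeault_wedgePow b s t hF (l + 3 - 1)
  rw [h0, map_zero, show l + 3 - 1 = l + 2 by omega, show l + 2 - 1 = l + 1 by omega,
    show l + 2 - 2 = l by omega, ← hfdef, ← hA, ← hβ, ← hB] at h0'
  have hrel : A + ((l : ℂ) + 1) • B = 0 := by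
    have h2 : ((l : ℂ) + 2) ≠ 0 := by exact_mod_cast (by omega : l + 2 ≠ 0)
    have : ((l : ℂ) + 2) • (A + ((l : ℂ) + 1) • B) = 0 := by
      rw [smul_add, smul_smul, h0']
      push_cast
      rfl
    exact (smul_eq_zero.mp this).resolve_left h2
  have hl1 : ((l : ℂ) + 1) ≠ 0 := by exact_mod_cast (by omega : l + 1 ≠ 0)
  have hAB : A = 0 ∧ B = 0 := by
    rcases h with h | h
    · have hA0 : A = 0 := by rw [hA, h, map_zero, mul_zero]
      rw [hA0, zero_add] at hrel
      exact ⟨hA0, (smul_eq_zero.mp hrel).resolve_left hl1⟩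
    · have h1 := toGrassmann_dolbeault_dolbeault_wedgePow b s t hF (l + 3 - 2)
      rw [h, map_zero, show l + 3 - 2 = l + 1 by omega, show l + 1 - 1 = l by omega,
        show l + 1 - 2 = l - 1 by omega, ← hfdef, ← hβ] at h1
      have h2 : ((l : ℂ) + 1) • (A + (l : ℂ) • B) = 0 := by
        have := congrArg (f * ·) h1
        simp only [mul_zero, mul_add, mul_smul_comm, ← mul_assoc, ← pow_succ'] at this
        rw [← hA] at this
        rw [smul_add, smul_smul, this]
        rcases l with _ | l
        · simp
        · simp [hB]
      have h3 := (smul_eq_zero.mp h2).resolve_left hl1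
      have hB0 : B = 0 := by
        have : (A + ((l : ℂ) + 1) • B) - (A + (l : ℂ) • B) = B := by
          rw [add_smul, one_smul]; abel
        rw [← this, hrel, h3, sub_zero]
      rw [hB0, smul_zero, add_zero] at h3
      exact ⟨h3, hB0⟩
  apply toGrassmann_injective b
  rw [map_zero, toGrassmann_wedge, toGrassmann_dolbeault_dolbeault_wedgePow b s t hF,
    toGrassmann_wedgePow, ← hfdef, ← hβ, add_mul, smul_mul_assoc, smul_mul_assoc]
  have hmove (j i : ℕ) (y : Grassmann N) : f ^ j * y * f ^ i = f ^ (j + i) * y := by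
    rw [mul_assoc, ← ((hc y).pow_left i).eq, ← mul_assoc, pow_add]
  rw [hmove, hmove, show k - 1 + (l + 3 - k - 1) = l + 1 by omega, ← hA, hAB.1, smul_zero,
    zero_add]
  rcases Nat.lt_or_ge k 2 with h2 | h2
  · simp [show k - 1 = 0 by omega]
  · rw [show k - 2 + (l + 3 - k - 1) = l by omega, ← hB, hAB.2, smul_zero]

end Calculus

theorem fderiv_real_I_smul {φ : Cn n → Cn n} {z : Cn n} (hφ : DifferentiableAt ℂ φ z) (v : Cn n) :
    fderiv ℝ φ z (Complex.I • v) = Complex.I • fderiv ℝ φ z v := by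
  rw [hφ.fderiv_restrictScalars ℝ]
  simp

theorem fderiv_fderiv_real_I_smul {φ : Cn n → Cn n} {z : Cn n} (hφ : ContDiffAt ℂ 2 φ z)
    (v w : Cn n) :
    fderiv ℝ (fderiv ℝ φ) z (Complex.I • v) w = Complex.I • fderiv ℝ (fderiv ℝ φ) z v w := by
  have hr : ContDiffAt ℝ 2 φ z := hφ.restrict_scalars ℝ
  have hsymm : ∀ x y, fderiv ℝ (fderiv ℝ φ) z x y = fderiv ℝ (fderiv ℝ φ) z y x :=
    hr.isSymmSndFDerivAt (by simp)
  have hd : DifferentiableAt ℝ (fderiv ℝ φ) z :=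
    (hr.fderiv_right (m := 1) (by norm_num)).differentiableAt (by simp)
  have hev : (fun z' => fderiv ℝ φ z' (Complex.I • v)) =ᶠ[nhds z]
      fun z' => Complex.I • fderiv ℝ φ z' v := by
    filter_upwards [hφ.eventually (by simp)] with z' hz'
    exact fderiv_real_I_smul (hz'.differentiableAt (by simp)) v
  have h1 (u : Cn n) : HasFDerivAt (fun z' => fderiv ℝ φ z' u)
      ((fderiv ℝ (fderiv ℝ φ) z).flip u) z := by
    simpa using hd.hasFDerivAt.clm_apply (hasFDerivAt_const u z)
  have h2 := hev.fderiv_eq (𝕜 := ℝ)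
  rw [(h1 _).fderiv, ((h1 v).fun_const_smul Complex.I).fderiv] at h2
  have h3 := DFunLike.congr_fun h2 w
  rw [hsymm, hsymm v w]
  exact h3

/-- The operators `∂` and `∂̄` commute with holomorphic pullbacks. -/
theorem dolbeault_pullback (s : ℂ) {α : Cn n → Cn n [⋀^Fin m]→L[ℝ] ℂ} {φ : Cn n → Cn n} {z : Cn n}
    (hα : DifferentiableAt ℝ α (φ z)) (hφ : ContDiffAt ℂ 2 φ z) :
    dolbeault s (fun z' => (α (φ z')).compContinuousLinearMap (fderiv ℝ φ z')) z =
      (dolbeault s α (φ z)).compContinuousLinearMap (fderiv ℝ φ z) := by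
  have hr : ContDiffAt ℝ 2 φ z := hφ.restrict_scalars ℝ
  have hsymm : ∀ x y, fderiv ℝ (fderiv ℝ φ) z x y = fderiv ℝ (fderiv ℝ φ) z y x :=
    hr.isSymmSndFDerivAt (by simp)
  have hd1 : DifferentiableAt ℝ φ z := hr.differentiableAt (by simp)
  have hd : DifferentiableAt ℝ (fderiv ℝ φ) z :=
    (hr.fderiv_right (m := 1) (by norm_num)).differentiableAt (by simp)
  set D := fderiv ℝ (fderiv ℝ φ) z with hD
  set P := (α (φ z)).fderivCompContinuousLinearMap (fderiv ℝ φ z) with hP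
  have hfd : fderiv ℝ (fun z' => (α (φ z')).compContinuousLinearMap (fderiv ℝ φ z')) z =
      (ContinuousAlternatingMap.compContinuousLinearMapCLM (fderiv ℝ φ z)).comp
        ((fderiv ℝ α (φ z)).comp (fderiv ℝ φ z)) + P.comp D := by
    rw [fderiv_continuousAlternatingMapCompContinuousLinearMap (by exact hα.comp z hd1) hd,
      fderiv_fun_comp z hα hd1]
  have hz1 : ContinuousAlternatingMap.alternatizeUncurryFin (P.comp D) = 0 :=
    ContinuousAlternatingMap.alternatizeUncurryFin_fderivCompContinuousLinearMap_eq_zero _ _ hsymm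
  have hz2 : ContinuousAlternatingMap.alternatizeUncurryFin (P.comp (D.comp (mulI n))) = 0 := by
    refine ContinuousAlternatingMap.alternatizeUncurryFin_fderivCompContinuousLinearMap_eq_zero
      _ _ fun x y => ?_
    change D (Complex.I • x) y = D (Complex.I • y) x
    rw [fderiv_fderiv_real_I_smul hφ, fderiv_fderiv_real_I_smul hφ, hsymm]
  have hsplit : dolbeault s (fun z' => (α (φ z')).compContinuousLinearMap (fderiv ℝ φ z')) z =
      ContinuousAlternatingMap.alternatizeUncurryFin
        ((ContinuousAlternatingMap.compContinuousLinearMapCLM (fderiv ℝ φ z)).comp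
          (((1 / 2 : ℂ) • (fderiv ℝ α (φ z) + s • (fderiv ℝ α (φ z)).comp (mulI n))).comp
            (fderiv ℝ φ z))) +
      (1 / 2 : ℂ) • (ContinuousAlternatingMap.alternatizeUncurryFin (P.comp D) +
        s • ContinuousAlternatingMap.alternatizeUncurryFin (P.comp (D.comp (mulI n)))) := by
    rw [dolbeault, hfd, ← ContinuousAlternatingMap.alternatizeUncurryFin_smul s,
      ← ContinuousAlternatingMap.alternatizeUncurryFin_add,
      ← ContinuousAlternatingMap.alternatizeUncurryFin_smul,
      ← ContinuousAlternatingMap.alternatizeUncurryFin_add]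
    congr 1
    ext v w
    have hI : fderiv ℝ φ z (mulI n v) = mulI n (fderiv ℝ φ z v) :=
      fderiv_real_I_smul (hφ.differentiableAt (by simp)) v
    simp only [_root_.smul_apply, _root_.add_apply,
      ContinuousLinearMap.comp_apply, ContinuousAlternatingMap.smul_apply,
      ContinuousAlternatingMap.add_apply, smul_eq_mul, hI,
      ContinuousAlternatingMap.compContinuousLinearMapCLM_apply,
      ContinuousAlternatingMap.compContinuousLinearMap_apply]
    ring
  rw [hsplit, hz1, hz2, smul_zero, add_zero, smul_zero, add_zero, dolbeault]
  ext v
  simp only [ContinuousAlternatingMap.alternatizeUncurryFin_apply,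
    ContinuousAlternatingMap.compContinuousLinearMap_apply, ContinuousLinearMap.comp_apply,
    ContinuousAlternatingMap.compContinuousLinearMapCLM_apply]
  rfl

theorem wedge_compContinuousLinearMap (α : Cn n [⋀^Fin p]→L[ℝ] ℂ) (β : Cn n [⋀^Fin q]→L[ℝ] ℂ)
    (L : Cn n →L[ℝ] Cn n) :
    wedge (α.compContinuousLinearMap L) (β.compContinuousLinearMap L) =
      (wedge α β).compContinuousLinearMap L := by
  ext v
  simp only [wedge_apply, ContinuousAlternatingMap.compContinuousLinearMap_apply]
  rfl

theorem wedgePow_compContinuousLinearMap (F : Cn n [⋀^Fin 2]→L[ℝ] ℂ) (L : Cn n →L[ℝ] Cn n)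
    (k : ℕ) : wedgePow (F.compContinuousLinearMap L) k =
      (wedgePow F k).compContinuousLinearMap L := by
  induction k with
  | zero => ext v; rfl
  | succ k ih => simp only [wedgePow, ih, wedge_compContinuousLinearMap]

/-- A top-degree form scales with the determinant. -/
theorem apply_map_basis_eq_det_smul (b : Module.Basis (Fin m) ℝ (Cn n)) (α : Cn n [⋀^Fin m]→L[ℝ] ℂ)
    (L : Cn n →L[ℝ] Cn n) : α (fun i => L (b i)) = (L.det : ℂ) * α b := by
  have h (ℓ : ℂ →L[ℝ] ℝ) : ℓ (α (fun i => L (b i))) = L.det * ℓ (α b) := by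
    have := ((ℓ : ℂ →ₗ[ℝ] ℝ).compAlternatingMap α.toAlternatingMap).eq_smul_basis_det b
    have h1 := congrArg (fun f : (Cn n) [⋀^Fin m]→ₗ[ℝ] ℝ => f (fun i => L (b i))) this
    have h2 : b.det (fun i => L (b i)) = L.det := by
      have := b.det_comp (L : Cn n →ₗ[ℝ] Cn n) b
      rw [b.det_self, mul_one] at this
      exact this
    simp only [AlternatingMap.smul_apply, smul_eq_mul, h2] at h1
    rw [mul_comm]
    exact h1
  apply Complex.ext
  · simpa using h Complex.reCLM
  · simpa using h Complex.imCLM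

theorem det_nonneg_of_I_smul (L : Cn n →L[ℝ] Cn n)
    (hL : ∀ v, L (Complex.I • v) = Complex.I • L v) : 0 ≤ L.det := by
  let L' : Cn n →ₗ[ℂ] Cn n :=
    { toFun := L
      map_add' := map_add L
      map_smul' := fun c v => by
        rw [← Complex.re_add_im c, RingHom.id_apply, add_smul, add_smul, map_add, mul_comm,
          mul_smul, mul_smul, hL]
        simp only [Complex.coe_smul, map_smul] }
  have h : (L'.restrictScalars ℝ).det = Algebra.norm ℝ L'.det := LinearMap.det_restrictScalars
  have h2 : L.det = (L'.restrictScalars ℝ).det := rfl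
  rw [h2, h, Algebra.norm_complex_eq]
  exact Complex.normSq_nonneg _

/-! ### Stokes' theorem on compact complex manifolds -/

theorem contDiff_indicator {E G : Type*} [NormedAddCommGroup E] [NormedSpace ℝ E]
    [NormedAddCommGroup G] [NormedSpace ℝ G] {r : WithTop ℕ∞} {U K : Set E} (hU : IsOpen U)
    (hK : IsCompact K) (hKU : K ⊆ U) {h : E → G} (hh : ContDiffOn ℝ r h U)
    (h0 : ∀ z ∈ U, z ∉ K → h z = 0) :
    ContDiff ℝ r (U.indicator h) ∧ HasCompactSupport (U.indicator h) := by
  have hout : ∀ z ∉ K, U.indicator h z = 0 := fun z hz => by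
    by_cases hzU : z ∈ U
    · rw [Set.indicator_of_mem hzU, h0 z hzU hz]
    · rw [Set.indicator_of_notMem hzU]
  refine ⟨contDiff_iff_contDiffAt.2 fun z => ?_, HasCompactSupport.intro hK hout⟩
  by_cases hz : z ∈ U
  · refine (hh.contDiffAt (hU.mem_nhds hz)).congr_of_eventuallyEq ?_
    filter_upwards [hU.mem_nhds hz] with z' hz' using Set.indicator_of_mem hz' h
  · refine contDiffAt_const (c := (0 : G)) |>.congr_of_eventuallyEq ?_
    filter_upwards [hK.isClosed.isOpen_compl.mem_nhds fun hzK => hz (hKU hzK)] with z' hz'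
    exact hout z' hz'

theorem continuous_indicator {E G : Type*} [NormedAddCommGroup E] [NormedSpace ℝ E]
    [NormedAddCommGroup G] [NormedSpace ℝ G] {U K : Set E} (hU : IsOpen U)
    (hK : IsCompact K) (hKU : K ⊆ U) {h : E → G} (hh : ContinuousOn h U)
    (h0 : ∀ z ∈ U, z ∉ K → h z = 0) :
    Continuous (U.indicator h) ∧ HasCompactSupport (U.indicator h) :=
  (contDiff_indicator hU hK hKU (contDiffOn_zero.2 hh) h0).imp_left ContDiff.continuous

theorem integral_fderiv_eq_zero {E G : Type*} [NormedAddCommGroup E] [NormedSpace ℝ E]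
    [FiniteDimensional ℝ E] [MeasurableSpace E] [BorelSpace E] (μ : Measure E) [μ.IsAddHaarMeasure]
    [NormedAddCommGroup G] [NormedSpace ℝ G] {g : E → G} (hg : ContDiff ℝ 1 g)
    (hs : HasCompactSupport g) (v : E) : ∫ x, fderiv ℝ g x v ∂μ = 0 := by
  have hc : Continuous fun x => fderiv ℝ g x v :=
    (hg.continuous_fderiv (by simp)).clm_apply continuous_const
  have hcs : HasCompactSupport fun x => fderiv ℝ g x v := hs.fderiv_apply ℝ v
  have := integral_smul_fderiv_eq_neg_fderiv_smul_of_integrable (μ := μ) (𝕜 := ℝ)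
    (f := fun _ : E => (1 : ℝ)) (g := g) (v := v) (by simp)
    (by simpa using hc.integrable_of_hasCompactSupport hcs)
    (by simpa using hg.continuous.integrable_of_hasCompactSupport hs)
    (fun x _ => by fun_prop) (fun x _ => hg.differentiable (by simp) x)
  simpa using this

theorem continuous_dolbeault_apply {s : ℂ} {α : Cn n → Cn n [⋀^Fin m]→L[ℝ] ℂ}
    {U : Set (Cn n)} (hU : IsOpen U) (hα : ContDiffOn ℝ 1 α U) (v : Fin (m + 1) → Cn n) :
    ContinuousOn (fun z => dolbeault s α z v) U := by
  intro z hz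
  have h1 := (contDiffAt_dolbeault (r := 0) s (hα.contDiffAt (hU.mem_nhds hz))
    (by simp)).continuousAt
  exact ((ContinuousAlternatingMap.apply ℝ (Cn n) ℂ v).continuous.continuousAt.comp
    h1).continuousWithinAt

theorem dolbeault_eq_zero {s : ℂ} {α : Cn n → Cn n [⋀^Fin m]→L[ℝ] ℂ} {z : Cn n}
    (h : α =ᶠ[nhds z] fun _ => 0) : dolbeault s α z = 0 := by
  ext v
  simp [dolbeault_congr s h, dolbeault_apply]

/-- The integral of `∂α` or `∂̄α` vanishes, for `α` a compactly supported form on `ℂⁿ`. -/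
theorem integral_dolbeault_eq_zero (μ : Measure (Cn n)) [μ.IsAddHaarMeasure] (s : ℂ)
    {α : Cn n → Cn n [⋀^Fin m]→L[ℝ] ℂ} (hα : ContDiff ℝ 1 α) (hs : HasCompactSupport α)
    (v : Fin (m + 1) → Cn n) : ∫ z, dolbeault s α z v ∂μ = 0 := by
  have hz (u : Cn n) (w : Fin m → Cn n) : ∫ z, fderiv ℝ α z u w ∂μ = 0 ∧
      Integrable (fun z => fderiv ℝ α z u w) μ := by
    set g : Cn n → ℂ := fun z => α z w
    have hg : ContDiff ℝ 1 g := (ContinuousAlternatingMap.apply ℝ (Cn n) ℂ w).contDiff.comp hα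
    have hgs : HasCompactSupport g := 
      hs.comp_left (g := fun β : Cn n [⋀^Fin m]→L[ℝ] ℂ => β w) rfl
    have hfd (z : Cn n) : fderiv ℝ g z u = fderiv ℝ α z u w := by
      have := ((ContinuousAlternatingMap.apply ℝ (Cn n) ℂ w).hasFDerivAt.comp z
        ((hα.differentiable (by simp)) z).hasFDerivAt).fderiv
      change fderiv ℝ g z = _ at this
      rw [this]; rfl
    simp only [← hfd]
    refine ⟨integral_fderiv_eq_zero μ hg hgs u, ?_⟩
    exact ((hg.continuous_fderiv (by simp)).clm_apply
      continuous_const).integrable_of_hasCompactSupport (hgs.fderiv_apply ℝ u)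
  have hadd (u u' : Cn n) (w : Fin m → Cn n) :
      Integrable (fun z => fderiv ℝ α z u w + s • fderiv ℝ α z u' w) μ :=
    (hz u w).2.add ((hz u' w).2.smul s)
  simp only [dolbeault_apply]
  rw [integral_finsetSum]
  swap
  · exact fun i _ => (hadd (v i) (Complex.I • v i) (i.removeNth v)).smul ((-1 : ℂ) ^ (i : ℕ) * (1 / 2))
  refine Finset.sum_eq_zero fun i _ => ?_
  rw [integral_smul, integral_add (hz _ _).2 (by exact (hz _ _).2.smul s), (hz _ _).1,
    integral_smul, (hz _ _).1, smul_zero, add_zero, smul_zero]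

variable {X : Type*} [TopologicalSpace X]

/-- The form `ρ θ` in the chart `e`, for a function `ρ` on `X`. -/
def cutoff (θ : OpenPartialHomeomorph X (Cn n) → Cn n → Cn n [⋀^Fin m]→L[ℝ] ℂ) (ρ : X → ℝ)
    (e : OpenPartialHomeomorph X (Cn n)) (z : Cn n) : Cn n [⋀^Fin m]→L[ℝ] ℂ :=
  ρ (e.symm z) • θ e z

theorem cutoff_eq_zero
    {θ : OpenPartialHomeomorph X (Cn n) → Cn n → Cn n [⋀^Fin m]→L[ℝ] ℂ} {ρ : X → ℝ} {e : OpenPartialHomeomorph X (Cn n)} {z : Cn n}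
    (h : ρ (e.symm z) = 0) : cutoff θ ρ e z = 0 := by
  ext v
  simp [cutoff, h]

theorem mem_source_transition {e e' : OpenPartialHomeomorph X (Cn n)} {z : Cn n} :
    z ∈ (e.symm ≫ₕ e').source ↔ z ∈ e.target ∧ e.symm z ∈ e'.source := by
  simp

/-- The image in a chart of the support of a function supported in the chart domain. -/
theorem isCompact_image_tsupport [CompactSpace X] {ρ : X → ℝ} {e : OpenPartialHomeomorph X (Cn n)}
    (hρ : tsupport ρ ⊆ e.source) : IsCompact (e '' tsupport ρ) ∧ e '' tsupport ρ ⊆ e.target :=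
  ⟨(isClosed_tsupport ρ).isCompact.image_of_continuousOn (e.continuousOn.mono hρ),
    (Set.image_mono hρ).trans e.image_source_eq_target.subset⟩

theorem symm_notMem_tsupport {ρ : X → ℝ} {e : OpenPartialHomeomorph X (Cn n)} {z : Cn n}
    (hz : z ∈ e.target) (h : z ∉ e '' tsupport ρ) : e.symm z ∉ tsupport ρ :=
  fun h' => h ⟨_, h', e.right_inv hz⟩

theorem dolbeault_cutoff_eq_zero
    {θ : OpenPartialHomeomorph X (Cn n) → Cn n → Cn n [⋀^Fin m]→L[ℝ] ℂ} {s : ℂ} {ρ : X → ℝ} {e : OpenPartialHomeomorph X (Cn n)} {z : Cn n}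
    (hz : z ∈ e.target) (hρ : e.symm z ∉ tsupport ρ) : dolbeault s (cutoff θ ρ e) z = 0 := by
  have hev : cutoff θ ρ e =ᶠ[nhds z] fun _ => 0 := by
    have h1 := (e.continuousAt_symm hz).preimage_mem_nhds
      ((isClosed_tsupport ρ).isOpen_compl.mem_nhds hρ)
    filter_upwards [h1] with y hy
    exact cutoff_eq_zero (image_eq_zero_of_notMem_tsupport hy)
  exact dolbeault_eq_zero hev

theorem integrableOn_of_tsupport [CompactSpace X] (μ : Measure (Cn n)) [μ.IsAddHaarMeasure]
    {G : Type*} [NormedAddCommGroup G] [NormedSpace ℝ G] {ρ : X → ℝ}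
    {e : OpenPartialHomeomorph X (Cn n)} (hρ : tsupport ρ ⊆ e.source) {h : Cn n → G}
    (hh : ContinuousOn h e.target) (h0 : ∀ z ∈ e.target, e.symm z ∉ tsupport ρ → h z = 0) :
    IntegrableOn h e.target μ := by
  have hK := isCompact_image_tsupport hρ
  have h1 := continuous_indicator e.open_target hK.1 hK.2 hh
    fun z hz hz' => h0 z hz (symm_notMem_tsupport hz hz')
  rw [← integrable_indicator_iff e.open_target.measurableSet]
  exact h1.1.integrable_of_hasCompactSupport h1.2

variable [ChartedSpace (Cn n) X]

theorem contDiffOn_transition [IsManifold 𝓘(ℂ, Cn n) ω X] {e e' : OpenPartialHomeomorph X (Cn n)}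
    (he : e ∈ atlas (Cn n) X) (he' : e' ∈ atlas (Cn n) X) :
    ContDiffOn ℂ ω (e' ∘ e.symm) (e.symm ≫ₕ e').source := by
  have h := (contDiffGroupoid ω 𝓘(ℂ, Cn n)).compatible he he'
  have h1 := (mem_groupoid_of_pregroupoid.1 h).1
  simpa [contDiffPregroupoid] using h1

theorem isManifold_real [IsManifold 𝓘(ℂ, Cn n) ω X] : IsManifold 𝓘(ℝ, Cn n) ∞ X := by
  refine isManifold_of_contDiffOn _ _ _ fun e e' he he' => ?_
  have h : ContDiffOn ℝ ∞ (e' ∘ e.symm) (e.symm ≫ₕ e').source :=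
    ((contDiffOn_transition he he').of_le le_top).restrict_scalars ℝ
  simpa using h

theorem contDiffOn_comp_symm [IsManifold 𝓘(ℝ, Cn n) ∞ X] {ρ : X → ℝ}
    (hρ : ContMDiff 𝓘(ℝ, Cn n) 𝓘(ℝ, ℝ) ∞ ρ) {e : OpenPartialHomeomorph X (Cn n)}
    (he : e ∈ atlas (Cn n) X) : ContDiffOn ℝ ∞ (fun z => ρ (e.symm z)) e.target :=
  contMDiffOn_iff_contDiffOn.1 (hρ.comp_contMDiffOn
    (contMDiffOn_symm_of_mem_maximalAtlas (IsManifold.subset_maximalAtlas he)))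

/-- A family of `m`-forms in the charts of `X` which is compatible with changes of charts. -/
structure IsCompatibleForm
    (θ : OpenPartialHomeomorph X (Cn n) → Cn n → Cn n [⋀^Fin m]→L[ℝ] ℂ) : Prop where
  contDiffOn : ∀ e ∈ atlas (Cn n) X, ContDiffOn ℝ 1 (θ e) e.target
  pullback : ∀ e ∈ atlas (Cn n) X, ∀ e' ∈ atlas (Cn n) X, ∀ z ∈ (e.symm ≫ₕ e').source,
    θ e z = (θ e' (e' (e.symm z))).compContinuousLinearMap (fderiv ℝ (e' ∘ e.symm) z)

section Stokes

variable {θ : OpenPartialHomeomorph X (Cn n) → Cn n → Cn n [⋀^Fin m]→L[ℝ] ℂ}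

theorem contDiffOn_cutoff [IsManifold 𝓘(ℝ, Cn n) ∞ X] (hθ : IsCompatibleForm θ) {ρ : X → ℝ}
    (hρ : ContMDiff 𝓘(ℝ, Cn n) 𝓘(ℝ, ℝ) ∞ ρ) {e : OpenPartialHomeomorph X (Cn n)}
    (he : e ∈ atlas (Cn n) X) : ContDiffOn ℝ 1 (cutoff θ ρ e) e.target :=
  ((contDiffOn_comp_symm hρ he).of_le (by exact_mod_cast le_top)).smul (hθ.contDiffOn e he)

theorem dolbeault_cutoff_transition [IsManifold 𝓘(ℂ, Cn n) ω X] [IsManifold 𝓘(ℝ, Cn n) ∞ X]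
    (s : ℂ) (hθ : IsCompatibleForm θ) {ρ : X → ℝ} (hρ : ContMDiff 𝓘(ℝ, Cn n) 𝓘(ℝ, ℝ) ∞ ρ)
    (b : Module.Basis (Fin (m + 1)) ℝ (Cn n))
    {e e' : OpenPartialHomeomorph X (Cn n)} (he : e ∈ atlas (Cn n) X) (he' : e' ∈ atlas (Cn n) X)
    {z : Cn n} (hz : z ∈ (e.symm ≫ₕ e').source) :
    dolbeault s (cutoff θ ρ e) z b =
      |(fderiv ℝ (e' ∘ e.symm) z).det| • dolbeault s (cutoff θ ρ e') (e' (e.symm z)) b := by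
  have hopen := (e.symm ≫ₕ e').open_source
  have hφ : ContDiffAt ℂ 2 (e' ∘ e.symm) z :=
    ((contDiffOn_transition he he').contDiffAt (hopen.mem_nhds hz)).of_le le_top
  have hz' := mem_source_transition.1 hz
  have hev : cutoff θ ρ e =ᶠ[nhds z] fun z' =>
      (cutoff θ ρ e' ((e' ∘ e.symm) z')).compContinuousLinearMap (fderiv ℝ (e' ∘ e.symm) z') := by
    filter_upwards [hopen.mem_nhds hz] with y hy
    rw [cutoff, hθ.pullback e he e' he' y hy, cutoff, Function.comp_apply,
      e'.left_inv (mem_source_transition.1 hy).2]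
    rfl
  have hd : DifferentiableAt ℝ (cutoff θ ρ e') ((e' ∘ e.symm) z) :=
    ((contDiffOn_cutoff hθ hρ he').contDiffAt
      (e'.open_target.mem_nhds (e'.map_source hz'.2))).differentiableAt (by simp)
  rw [dolbeault_congr s hev, dolbeault_pullback s hd hφ,
    ContinuousAlternatingMap.compContinuousLinearMap_apply,
    abs_of_nonneg (det_nonneg_of_I_smul _
      (fderiv_real_I_smul (hφ.differentiableAt (by simp)))), Complex.real_smul]
  exact apply_map_basis_eq_det_smul b _ _

theorem integral_dolbeault_cutoff [CompactSpace X] [IsManifold 𝓘(ℝ, Cn n) ∞ X]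
    (μ : Measure (Cn n)) [μ.IsAddHaarMeasure] (s : ℂ) (hθ : IsCompatibleForm θ) {ρ : X → ℝ}
    (hρ : ContMDiff 𝓘(ℝ, Cn n) 𝓘(ℝ, ℝ) ∞ ρ) {e : OpenPartialHomeomorph X (Cn n)}
    (he : e ∈ atlas (Cn n) X) (hρe : tsupport ρ ⊆ e.source) (v : Fin (m + 1) → Cn n) :
    ∫ z in e.target, dolbeault s (cutoff θ ρ e) z v ∂μ = 0 := by
  have hK := isCompact_image_tsupport hρe
  have h1 := contDiff_indicator e.open_target hK.1 hK.2 (contDiffOn_cutoff hθ hρ he)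
    fun z hz hz' => by
      exact cutoff_eq_zero (image_eq_zero_of_notMem_tsupport (symm_notMem_tsupport hz hz'))
  have h2 : ∀ z ∈ e.target, dolbeault s (cutoff θ ρ e) z v =
      dolbeault s (e.target.indicator (cutoff θ ρ e)) z v := fun z hz => by
    have hev : cutoff θ ρ e =ᶠ[nhds z] e.target.indicator (cutoff θ ρ e) := by
      filter_upwards [e.open_target.mem_nhds hz] with y hy
      rw [Set.indicator_of_mem hy]
    rw [dolbeault_congr s hev]
  rw [setIntegral_congr_fun e.open_target.measurableSet h2,
    setIntegral_eq_integral_of_forall_compl_eq_zero,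
    integral_dolbeault_eq_zero μ s h1.1 h1.2]
  intro z hz
  have hev : e.target.indicator (cutoff θ ρ e) =ᶠ[nhds z] fun _ => 0 := by
    filter_upwards [hK.1.isClosed.isOpen_compl.mem_nhds fun hzK => hz (hK.2 hzK)] with y hy
    by_cases hyt : y ∈ e.target
    · rw [Set.indicator_of_mem hyt,
        cutoff_eq_zero (image_eq_zero_of_notMem_tsupport (symm_notMem_tsupport hyt hy))]
    · rw [Set.indicator_of_notMem hyt]
  rw [dolbeault_eq_zero hev]
  rfl

/-- Change of charts in an integral of `ρ' ∂(ρθ)`. -/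
theorem integral_mul_dolbeault_cutoff_eq [IsManifold 𝓘(ℂ, Cn n) ω X]
    [IsManifold 𝓘(ℝ, Cn n) ∞ X] (μ : Measure (Cn n)) [μ.IsAddHaarMeasure] (s : ℂ)
    (hθ : IsCompatibleForm θ) {ρ ρ' : X → ℝ} (hρ : ContMDiff 𝓘(ℝ, Cn n) 𝓘(ℝ, ℝ) ∞ ρ)
    (b : Module.Basis (Fin (m + 1)) ℝ (Cn n)) {e e' : OpenPartialHomeomorph X (Cn n)}
    (he : e ∈ atlas (Cn n) X) (he' : e' ∈ atlas (Cn n) X)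
    (hρe : tsupport ρ ⊆ e.source) (hρe' : tsupport ρ' ⊆ e'.source) :
    ∫ z in e'.target, ρ' (e'.symm z) • dolbeault s (cutoff θ ρ e') z b ∂μ =
      ∫ z in e.target, ρ' (e.symm z) • dolbeault s (cutoff θ ρ e) z b ∂μ := by
  set V := (e.symm ≫ₕ e').source with hV
  set V' := (e.symm ≫ₕ e').target with hV'
  have hopen := (e.symm ≫ₕ e').open_source
  have himg : (e' ∘ e.symm) '' V = V' := (e.symm ≫ₕ e').image_source_eq_target
  have hVe : V ⊆ e.target := fun z hz => (mem_source_transition.1 hz).1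
  have hmem' {z : Cn n} : z ∈ V' ↔ z ∈ e'.target ∧ e'.symm z ∈ e.source := by
    rw [hV', OpenPartialHomeomorph.trans_target]
    simp
  rw [setIntegral_eq_of_subset_of_forall_sdiff_eq_zero (s := V') e'.open_target.measurableSet
      (fun z hz => (hmem'.1 hz).1) (fun z hz => ?_),
    setIntegral_eq_of_subset_of_forall_sdiff_eq_zero (s := V) e.open_target.measurableSet hVe
      (fun z hz => ?_), ← himg, integral_image_eq_integral_abs_det_fderiv_smul μ
      hopen.measurableSet (f := e' ∘ e.symm) (f' := fun z => fderiv ℝ (e' ∘ e.symm) z) (fun z hz => ?_)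
      (e.symm ≫ₕ e').injOn]
  · refine setIntegral_congr_fun hopen.measurableSet fun z hz => ?_
    simp only [Function.comp_apply]
    rw [e'.left_inv (mem_source_transition.1 hz).2,
      dolbeault_cutoff_transition s hθ hρ b he he' hz, smul_comm]
  · exact ((((contDiffOn_transition he he').contDiffAt (hopen.mem_nhds hz)).restrict_scalars
      ℝ).differentiableAt (by simp)).hasFDerivAt.hasFDerivWithinAt
  · have : e.symm z ∉ tsupport ρ' := fun h =>
      hz.2 (mem_source_transition.2 ⟨hz.1, hρe' h⟩)
    rw [image_eq_zero_of_notMem_tsupport this, zero_smul]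
  · have : e'.symm z ∉ tsupport ρ := fun h => hz.2 (hmem'.2 ⟨hz.1, hρe h⟩)
    rw [dolbeault_cutoff_eq_zero hz.1 this]
    simp

theorem dolbeault_eq_sum_cutoff [IsManifold 𝓘(ℝ, Cn n) ∞ X] (s : ℂ) (hθ : IsCompatibleForm θ)
    {ι : Type*} [Fintype ι] {ρ : ι → X → ℝ} (hρ : ∀ i, ContMDiff 𝓘(ℝ, Cn n) 𝓘(ℝ, ℝ) ∞ (ρ i))
    (hsum : ∀ x, ∑ i, ρ i x = 1) {e : OpenPartialHomeomorph X (Cn n)} (he : e ∈ atlas (Cn n) X)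
    {z : Cn n} (hz : z ∈ e.target) :
    dolbeault s (θ e) z = ∑ i, dolbeault s (cutoff θ (ρ i) e) z := by
  have h1 : θ e = fun z' => ∑ i, cutoff θ (ρ i) e z' := by
    funext z'
    simp [cutoff, ← Finset.sum_smul, hsum]
  have hd (i : ι) : DifferentiableAt ℝ (cutoff θ (ρ i) e) z :=
    ((contDiffOn_cutoff hθ (hρ i) he).contDiffAt
      (e.open_target.mem_nhds hz)).differentiableAt (by simp)
  simp only [← dolbeaultCLM_fderiv]
  rw [h1, fderiv_fun_sum fun i _ => hd i, map_sum]

/-- On a compact complex manifold, the form `∂θ` (or `∂̄θ`) is not a nonzero constant multiple of a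
positive density. -/
theorem const_eq_zero_of_dolbeault_eq [IsManifold 𝓘(ℂ, Cn n) ω X] [T2Space X] [CompactSpace X]
    [Nonempty X] (s : ℂ) (hθ : IsCompatibleForm θ) (b : Module.Basis (Fin (m + 1)) ℝ (Cn n))
    {w : OpenPartialHomeomorph X (Cn n) → Cn n → ℝ}
    (hw : ∀ e ∈ atlas (Cn n) X, ContinuousOn (w e) e.target)
    (hpos : ∀ e ∈ atlas (Cn n) X, ∀ z ∈ e.target, 0 < w e z) {c : ℂ}
    (hc : ∀ e ∈ atlas (Cn n) X, ∀ z ∈ e.target, dolbeault s (θ e) z b = w e z • c) : c = 0 := by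
  have : IsManifold 𝓘(ℝ, Cn n) ∞ X := isManifold_real
  let μ : Measure (Cn n) := b.addHaar
  obtain ⟨t, -, ht⟩ := (isCompact_univ (X := X)).elim_nhds_subcover
    (fun x => (chartAt (Cn n) x).source) fun x _ => chart_source_mem_nhds _ x
  obtain ⟨ρ, hρ⟩ := SmoothPartitionOfUnity.exists_isSubordinate 𝓘(ℝ, Cn n) isClosed_univ
    (fun x : t => (chartAt (Cn n) (x : X)).source) (fun x => (chartAt (Cn n) (x : X)).open_source)
    (ht.trans (by simp [Set.iUnion_subtype]))
  let e : t → OpenPartialHomeomorph X (Cn n) := fun x => chartAt (Cn n) (x : X)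
  have he (i : t) : e i ∈ atlas (Cn n) X := chart_mem_atlas _ _
  have hsm (i : t) : ContMDiff 𝓘(ℝ, Cn n) 𝓘(ℝ, ℝ) ∞ (ρ i) := (ρ i).contMDiff
  have hsum (x : X) : ∑ i, ρ i x = 1 := by
    rw [← finsum_eq_sum_of_fintype]
    exact ρ.sum_eq_one (Set.mem_univ x)
  have hcont (i j : t) : ContinuousOn (fun z => dolbeault s (cutoff θ (ρ j) (e i)) z b)
      (e i).target :=
    continuous_dolbeault_apply (e i).open_target (contDiffOn_cutoff hθ (hsm j) (he i)) b
  have hρc (i j : t) : ContinuousOn (fun z => ρ j ((e i).symm z)) (e i).target :=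
    (contDiffOn_comp_symm (hsm j) (he i)).continuousOn
  have hzero : ∑ j, ∫ z in (e j).target, ρ j ((e j).symm z) • dolbeault s (θ (e j)) z b ∂μ = 0 := by
    have h1 (j : t) : ∫ z in (e j).target, ρ j ((e j).symm z) • dolbeault s (θ (e j)) z b ∂μ =
        ∑ i, ∫ z in (e i).target,
          ρ j ((e i).symm z) • dolbeault s (cutoff θ (ρ i) (e i)) z b ∂μ := by
      have h2 (i : t) := integral_mul_dolbeault_cutoff_eq μ s hθ (hsm i) b (he i) (he j)
        (hρ i) (hρ j)
      simp only [← h2]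
      rw [← integral_finsetSum]
      · refine setIntegral_congr_fun (e j).open_target.measurableSet fun z hz => ?_
        simp only [dolbeault_eq_sum_cutoff s hθ hsm hsum (he j) hz,
          ContinuousAlternatingMap.sum_apply, Finset.smul_sum]
      · intro i _
        refine integrableOn_of_tsupport μ (hρ j) ((hρc j j).smul (hcont j i)) fun z _ hz => ?_
        rw [image_eq_zero_of_notMem_tsupport hz, zero_smul]
    simp only [h1]
    rw [Finset.sum_comm]
    refine Finset.sum_eq_zero fun i _ => ?_
    rw [← integral_finsetSum]
    · simp only [← Finset.sum_smul, hsum, one_smul]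
      exact integral_dolbeault_cutoff μ s hθ (hsm i) (he i) (hρ i) b
    · intro j _
      refine integrableOn_of_tsupport μ (hρ i) ((hρc i j).smul (hcont i i)) fun z hz hz' => ?_
      rw [dolbeault_cutoff_eq_zero hz hz']
      simp
  have hmass : 0 < ∑ j, ∫ z in (e j).target, ρ j ((e j).symm z) * w (e j) z ∂μ := by
    have hind (j : t) := continuous_indicator (e j).open_target
      (isCompact_image_tsupport (hρ j)).1 (isCompact_image_tsupport (hρ j)).2
      ((hρc j j).mul (hw (e j) (he j))) fun z hz hz' => by
        rw [Pi.mul_apply, image_eq_zero_of_notMem_tsupport (symm_notMem_tsupport hz hz'),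
          zero_mul]
    have hnn (j : t) : 0 ≤ (e j).target.indicator
        fun z => ρ j ((e j).symm z) * w (e j) z :=
      fun z => Set.indicator_nonneg (fun z hz =>
        mul_nonneg (ρ.nonneg _ _) (hpos _ (he j) z hz).le) z
    obtain ⟨x⟩ := ‹Nonempty X›
    obtain ⟨i, hi⟩ := ρ.exists_pos_of_mem (Set.mem_univ x)
    have hxi : x ∈ (e i).source := hρ i (subset_tsupport _ hi.ne')
    refine Finset.sum_pos' (fun j _ => ?_) ⟨i, Finset.mem_univ i, ?_⟩
    · rw [← integral_indicator (e j).open_target.measurableSet]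
      exact integral_nonneg (hnn j)
    · rw [← integral_indicator (e i).open_target.measurableSet]
      refine (hind i).1.integral_pos_of_hasCompactSupport_nonneg_nonzero (x := e i x)
        (hind i).2 (hnn i) ?_
      rw [Set.indicator_of_mem ((e i).map_source hxi), (e i).left_inv hxi]
      exact (mul_pos hi (hpos _ (he i) _ ((e i).map_source hxi))).ne'
  have hfin : (∑ j, ∫ z in (e j).target, ρ j ((e j).symm z) * w (e j) z ∂μ) • c = 0 := by
    rw [← hzero, Finset.sum_smul]
    refine Finset.sum_congr rfl fun j _ => ?_
    rw [← integral_smul_const]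
    refine setIntegral_congr_fun (e j).open_target.measurableSet fun z hz => ?_
    simp only [hc _ (he j) z hz, smul_smul]
  exact (smul_eq_zero.mp hfin).resolve_left hmass.ne'

end Stokes

/-! ### Local symmetries of a Hermitian metric -/

section Differential

variable {X Y Z : Type*} [TopologicalSpace X] [ChartedSpace (Cn n) X] [TopologicalSpace Y]
  [ChartedSpace (Cn n) Y] [TopologicalSpace Z] [ChartedSpace (Cn n) Z]

theorem realDifferential_apply (f : X → Y) (x : X) (v : Cn n) :
    realDifferential (n := n) f x v = (show Cn n from mfderiv 𝓘(ℂ, Cn n) 𝓘(ℂ, Cn n) f x v) := rfl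

theorem realDifferential_comp {g : Y → Z} {f : X → Y} {x : X}
    (hg : MDifferentiableAt 𝓘(ℂ, Cn n) 𝓘(ℂ, Cn n) g (f x))
    (hf : MDifferentiableAt 𝓘(ℂ, Cn n) 𝓘(ℂ, Cn n) f x) :
    realDifferential (n := n) (g ∘ f) x =
      (realDifferential (n := n) g (f x)).comp (realDifferential f x) := by
  ext1 v
  rw [realDifferential_apply, mfderiv_comp x hg hf]
  rfl

theorem realDifferential_congr {f g : X → Y} {x : X} (h : f =ᶠ[nhds x] g) :
    realDifferential (n := n) f x = realDifferential g x := by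
  ext1 v
  rw [realDifferential_apply, realDifferential_apply, h.mfderiv_eq]
  rfl

theorem realDifferential_id (x : X) :
    realDifferential (n := n) (id : X → X) x = ContinuousLinearMap.id ℝ (Cn n) := by
  ext1 v
  rw [realDifferential_apply, mfderiv_id]
  rfl

theorem realDifferential_eq_fderiv {f : Cn n → Cn n} {z : Cn n} (hf : DifferentiableAt ℂ f z) :
    realDifferential (n := n) f z = fderiv ℝ f z := by
  rw [hf.fderiv_restrictScalars ℝ]
  ext1 v
  rw [realDifferential_apply, mfderiv_eq_fderiv]
  rfl

theorem realDifferential_I_smul (f : X → Y) (x : X) (v : Cn n) :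
    realDifferential (n := n) f x (Complex.I • v) = Complex.I • realDifferential (n := n) f x v :=
  map_smul (show Cn n →L[ℂ] Cn n from mfderiv 𝓘(ℂ, Cn n) 𝓘(ℂ, Cn n) f x) Complex.I v

theorem pullbackForm_comp {g : Y → Z} {f : X → Y} {x : X}
    (hg : MDifferentiableAt 𝓘(ℂ, Cn n) 𝓘(ℂ, Cn n) g (f x))
    (hf : MDifferentiableAt 𝓘(ℂ, Cn n) 𝓘(ℂ, Cn n) f x) (α : Z → Cn n [⋀^Fin m]→L[ℝ] ℝ) :
    pullbackForm (n := n) (g ∘ f) α x = pullbackForm f (pullbackForm (n := n) g α) x := by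
  rw [pullbackForm, realDifferential_comp hg hf]
  rfl

theorem pullbackForm_congr {f g : X → Y} {x : X} (h : f =ᶠ[nhds x] g)
    (α : Y → Cn n [⋀^Fin m]→L[ℝ] ℝ) :
    pullbackForm (n := n) f α x = pullbackForm g α x := by
  rw [pullbackForm, pullbackForm, realDifferential_congr h, h.self_of_nhds]

theorem pullbackForm_id (α : X → Cn n [⋀^Fin m]→L[ℝ] ℝ) (x : X) :
    pullbackForm (n := n) (id : X → X) α x = α x := by
  rw [pullbackForm, realDifferential_id]
  rfl

theorem pullbackForm_eq_of_eq {f : X → Y} {x : X} {α β : Y → Cn n [⋀^Fin m]→L[ℝ] ℝ}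
    (h : α (f x) = β (f x)) : pullbackForm (n := n) f α x = pullbackForm f β x := by
  rw [pullbackForm, pullbackForm, h]

end Differential

variable {X : Type*} [TopologicalSpace X] [ChartedSpace (Cn n) X]

/-- A holomorphic map `χ`, defined on an open subset `U` of `X`, which preserves `F`. -/
structure IsLocalSymmetry (F : HermitianMetric n X) (χ : X → X) (U : Set X) : Prop where
  isOpen : IsOpen U
  contMDiffOn : ContMDiffOn 𝓘(ℂ, Cn n) 𝓘(ℂ, Cn n) ω χ U
  pullback : ∀ x ∈ U, pullbackForm (n := n) χ F.form x = F.form x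

theorem isLocalSymmetry_id (F : HermitianMetric n X) : IsLocalSymmetry F id Set.univ :=
  ⟨isOpen_univ, contMDiffOn_id, fun x _ => pullbackForm_id _ x⟩

/-- The subset of the chart `e` on which `χ : U → X` can be read in the charts `e` and `e'`. -/
def readDomain (χ : X → X) (U : Set X) (e e' : OpenPartialHomeomorph X (Cn n)) : Set (Cn n) :=
  e.target ∩ e.symm ⁻¹' (U ∩ χ ⁻¹' e'.source)

section LocalSymmetry

variable {F : HermitianMetric n X} {χ : X → X} {U : Set X} {e e' : OpenPartialHomeomorph X (Cn n)}

theorem IsLocalSymmetry.isOpen_readDomain (h : IsLocalSymmetry F χ U) :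
    IsOpen (readDomain χ U e e') :=
  e.isOpen_inter_preimage_symm
    (h.contMDiffOn.continuousOn.isOpen_inter_preimage h.isOpen e'.open_source)

theorem contDiffOn_inChart (F : HermitianMetric n X) (he : e ∈ atlas (Cn n) X) :
    ContDiffOn ℝ ∞ (F.inChart e) e.target :=
  have h : ContDiff ℝ ∞
      (ContinuousLinearMap.compContinuousAlternatingMapCLM ℝ (Cn n) ℝ ℂ (ι := Fin 2) Complex.ofRealCLM) := by
    fun_prop
  h.comp_contDiffOn (F.smooth e he)

/-- The form `∂̄Fᵏ` (or `∂Fᵏ`) in the chart `e`. -/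
def dolbeaultPow (F : HermitianMetric n X) (s : ℂ) (k : ℕ) (e : OpenPartialHomeomorph X (Cn n)) :
    Cn n → Cn n [⋀^Fin (2 * k + 1)]→L[ℝ] ℂ :=
  dolbeault s fun z => wedgePow (F.inChart e z) k

theorem contDiffAt_dolbeaultPow (F : HermitianMetric n X) (he : e ∈ atlas (Cn n) X) (s : ℂ) (k : ℕ)
    {z : Cn n} (hz : z ∈ e.target) : ContDiffAt ℝ 1 (dolbeaultPow F s k e) z :=
  contDiffAt_dolbeault (r' := 2) s (contDiffAt_wedgePow
    (((contDiffOn_inChart F he).contDiffAt (e.open_target.mem_nhds hz)).of_le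
      ENat.LEInfty.out) k) (by norm_num)

variable [IsManifold 𝓘(ℂ, Cn n) ω X]

theorem IsLocalSymmetry.contDiffAt (h : IsLocalSymmetry F χ U) (he : e ∈ atlas (Cn n) X)
    (he' : e' ∈ atlas (Cn n) X) {z : Cn n} (hz : z ∈ readDomain χ U e e') :
    ContDiffAt ℂ ω (e' ∘ χ ∘ e.symm) z := by
  have h1 : ContMDiffAt 𝓘(ℂ, Cn n) 𝓘(ℂ, Cn n) ω e.symm z :=
    contMDiffAt_symm_of_mem_maximalAtlas (IsManifold.subset_maximalAtlas he) hz.1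
  have h2 : ContMDiffAt 𝓘(ℂ, Cn n) 𝓘(ℂ, Cn n) ω χ (e.symm z) :=
    h.contMDiffOn.contMDiffAt (h.isOpen.mem_nhds hz.2.1)
  have h3 : ContMDiffAt 𝓘(ℂ, Cn n) 𝓘(ℂ, Cn n) ω e' (χ (e.symm z)) :=
    contMDiffAt_of_mem_maximalAtlas (IsManifold.subset_maximalAtlas he') hz.2.2
  exact contMDiffAt_iff_contDiffAt.1 (h3.comp z (h2.comp z h1))

theorem IsLocalSymmetry.pullbackForm_symm (h : IsLocalSymmetry F χ U) (he : e ∈ atlas (Cn n) X)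
    (he' : e' ∈ atlas (Cn n) X) {z : Cn n} (hz : z ∈ readDomain χ U e e') :
    pullbackForm (n := n) e.symm F.form z =
      (pullbackForm (n := n) e'.symm F.form (e' (χ (e.symm z)))).compContinuousLinearMap
        (fderiv ℝ (e' ∘ χ ∘ e.symm) z) := by
  have h1 : MDifferentiableAt 𝓘(ℂ, Cn n) 𝓘(ℂ, Cn n) e.symm z :=
    (contMDiffAt_symm_of_mem_maximalAtlas (n := ω) (IsManifold.subset_maximalAtlas he)
      hz.1).mdifferentiableAt (by simp)
  have h2 : MDifferentiableAt 𝓘(ℂ, Cn n) 𝓘(ℂ, Cn n) χ (e.symm z) :=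
    (h.contMDiffOn.contMDiffAt (h.isOpen.mem_nhds hz.2.1)).mdifferentiableAt (by simp)
  have h3 : MDifferentiableAt 𝓘(ℂ, Cn n) 𝓘(ℂ, Cn n) e'.symm (e' (χ (e.symm z))) :=
    (contMDiffAt_symm_of_mem_maximalAtlas (n := ω) (IsManifold.subset_maximalAtlas he')
      (e'.map_source hz.2.2)).mdifferentiableAt (by simp)
  have h4 := (h.contDiffAt he he' hz).differentiableAt (by simp)
  have hev : e'.symm ∘ (e' ∘ χ ∘ e.symm) =ᶠ[nhds z] χ ∘ e.symm := by
    filter_upwards [h.isOpen_readDomain.mem_nhds hz] with y hy using e'.left_inv hy.2.2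
  calc pullbackForm (n := n) e.symm F.form z
      = pullbackForm (n := n) e.symm (pullbackForm (n := n) χ F.form) z :=
        pullbackForm_eq_of_eq (h.pullback _ hz.2.1).symm
    _ = pullbackForm (n := n) (χ ∘ e.symm) F.form z := (pullbackForm_comp h2 h1 _).symm
    _ = pullbackForm (n := n) (e'.symm ∘ (e' ∘ χ ∘ e.symm)) F.form z :=
        (pullbackForm_congr hev _).symm
    _ = pullbackForm (n := n) (e' ∘ χ ∘ e.symm) (pullbackForm (n := n) e'.symm F.form) z :=
        pullbackForm_comp (g := e'.symm) (f := e' ∘ χ ∘ e.symm) h3 h4.mdifferentiableAt _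
    _ = _ := by
        rw [pullbackForm, realDifferential_eq_fderiv h4]
        rfl

theorem IsLocalSymmetry.inChart (h : IsLocalSymmetry F χ U) (he : e ∈ atlas (Cn n) X)
    (he' : e' ∈ atlas (Cn n) X) {z : Cn n} (hz : z ∈ readDomain χ U e e') :
    F.inChart e z = (F.inChart e' ((e' ∘ χ ∘ e.symm) z)).compContinuousLinearMap
      (fderiv ℝ (e' ∘ χ ∘ e.symm) z) := by
  rw [HermitianMetric.inChart, h.pullbackForm_symm he he' hz]
  rfl

theorem IsLocalSymmetry.dolbeaultPow (h : IsLocalSymmetry F χ U) (he : e ∈ atlas (Cn n) X)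
    (he' : e' ∈ atlas (Cn n) X) (s : ℂ) (k : ℕ) {z : Cn n} (hz : z ∈ readDomain χ U e e') :
    dolbeaultPow F s k e z =
      (dolbeaultPow F s k e' ((e' ∘ χ ∘ e.symm) z)).compContinuousLinearMap
        (fderiv ℝ (e' ∘ χ ∘ e.symm) z) := by
  have hev : (fun y => wedgePow (F.inChart e y) k) =ᶠ[nhds z] fun y =>
      (wedgePow (F.inChart e' ((e' ∘ χ ∘ e.symm) y)) k).compContinuousLinearMap
        (fderiv ℝ (e' ∘ χ ∘ e.symm) y) := by
    filter_upwards [h.isOpen_readDomain.mem_nhds hz] with y hy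
    rw [h.inChart he he' hy, wedgePow_compContinuousLinearMap]
  have hd : DifferentiableAt ℝ (fun y => wedgePow (F.inChart e' y) k) ((e' ∘ χ ∘ e.symm) z) :=
    (contDiffAt_wedgePow ((contDiffOn_inChart F he').contDiffAt
      (e'.open_target.mem_nhds (e'.map_source hz.2.2))) k).differentiableAt (by simp)
  rw [KGauduchon.dolbeaultPow, dolbeault_congr s hev,
    dolbeault_pullback s hd ((h.contDiffAt he he' hz).of_le le_top)]
  rfl

theorem isCompatibleForm_dolbeaultPow (F : HermitianMetric n X) (s : ℂ) (k : ℕ) :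
    IsCompatibleForm (dolbeaultPow F s k) where
  contDiffOn _ he _ hz := (contDiffAt_dolbeaultPow F he s k hz).contDiffWithinAt
  pullback _ he _ he' _ hz := (isLocalSymmetry_id F).dolbeaultPow he he' s k
    ⟨(mem_source_transition.1 hz).1, Set.mem_univ _, (mem_source_transition.1 hz).2⟩

theorem IsLocalSymmetry.dolbeault_dolbeaultPow (h : IsLocalSymmetry F χ U)
    (he : e ∈ atlas (Cn n) X) (he' : e' ∈ atlas (Cn n) X) (s t : ℂ) (k : ℕ) {z : Cn n}
    (hz : z ∈ readDomain χ U e e') :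
    dolbeault t (KGauduchon.dolbeaultPow F s k e) z =
      (dolbeault t (KGauduchon.dolbeaultPow F s k e')
        ((e' ∘ χ ∘ e.symm) z)).compContinuousLinearMap (fderiv ℝ (e' ∘ χ ∘ e.symm) z) := by
  have hev : KGauduchon.dolbeaultPow F s k e =ᶠ[nhds z] fun y =>
      (KGauduchon.dolbeaultPow F s k e' ((e' ∘ χ ∘ e.symm) y)).compContinuousLinearMap
        (fderiv ℝ (e' ∘ χ ∘ e.symm) y) := by
    filter_upwards [h.isOpen_readDomain.mem_nhds hz] with y hy using h.dolbeaultPow he he' s k hy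
  rw [dolbeault_congr t hev, dolbeault_pullback t ((contDiffAt_dolbeaultPow F he' s k
    (e'.map_source hz.2.2)).differentiableAt (by simp)) ((h.contDiffAt he he' hz).of_le le_top)]

end LocalSymmetry

/-! ### The volume density of a Hermitian metric -/

theorem update_vecCons_zero {E : Type*} (u v w : E) :
    Function.update ![u, v] 0 w = ![w, v] := by
  ext i
  fin_cases i <;> rfl

theorem update_vecCons_one {E : Type*} (u v w : E) :
    Function.update ![u, v] 1 w = ![u, w] := by
  ext i
  fin_cases i <;> rfl

/-- The bilinear form `(v, w) ↦ β(v, Jw)`. -/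
def hermitianBilin (β : Cn n [⋀^Fin 2]→L[ℝ] ℝ) : LinearMap.BilinForm ℝ (Cn n) :=
  LinearMap.mk₂ ℝ (fun v w => β ![v, Complex.I • w])
    (fun v v' w => by
      have h := β.toAlternatingMap.map_update_add ![0, Complex.I • w] 0 v v'
      simp only [update_vecCons_zero] at h ⊢
      exact h)
    (fun c v w => by
      have h := β.toAlternatingMap.map_update_smul ![0, Complex.I • w] 0 c v
      simp only [update_vecCons_zero] at h ⊢
      exact h)
    (fun v w w' => by
      have h := β.toAlternatingMap.map_update_add ![v, 0] 1 (Complex.I • w) (Complex.I • w')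
      simp only [update_vecCons_one, smul_add] at h ⊢
      exact h)
    (fun c v w => by
      have h := β.toAlternatingMap.map_update_smul ![v, 0] 1 c (Complex.I • w)
      simp only [update_vecCons_one, smul_comm Complex.I c w] at h ⊢
      exact h)

theorem hermitianBilin_apply (β : Cn n [⋀^Fin 2]→L[ℝ] ℝ) (v w : Cn n) :
    hermitianBilin β v w = β ![v, Complex.I • w] := rfl

/-- The Riemannian volume density in the basis `b` of the metric with fundamental form `β`. -/
def density (b : Module.Basis (Fin N) ℝ (Cn n)) (β : Cn n [⋀^Fin 2]→L[ℝ] ℝ) : ℝ :=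
  √|(LinearMap.BilinForm.toMatrix b (hermitianBilin β)).det|

theorem density_comp (b : Module.Basis (Fin N) ℝ (Cn n)) (β : Cn n [⋀^Fin 2]→L[ℝ] ℝ)
    {L : Cn n →L[ℝ] Cn n} (hL : ∀ v, L (Complex.I • v) = Complex.I • L v) :
    density b (β.compContinuousLinearMap L) = |L.det| * density b β := by
  have h1 : hermitianBilin (β.compContinuousLinearMap L) =
      (hermitianBilin β).comp (L : Cn n →ₗ[ℝ] Cn n) (L : Cn n →ₗ[ℝ] Cn n) := by
    refine LinearMap.ext₂ fun v w => ?_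
    simp only [hermitianBilin_apply, LinearMap.BilinForm.comp_apply,
      ContinuousAlternatingMap.compContinuousLinearMap_apply, ContinuousLinearMap.coe_coe]
    rw [← hL]
    congr 1
    ext i
    fin_cases i <;> rfl
  have h2 : (LinearMap.toMatrix b b (L : Cn n →ₗ[ℝ] Cn n)).det = L.det :=
    LinearMap.det_toMatrix b _
  rw [density, h1, LinearMap.BilinForm.toMatrix_comp b b, Matrix.det_mul, Matrix.det_mul,
    Matrix.det_transpose, h2, density, mul_right_comm, abs_mul, abs_mul_self,
    Real.sqrt_mul (mul_self_nonneg _), Real.sqrt_mul_self_eq_abs]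

theorem density_pos (b : Module.Basis (Fin N) ℝ (Cn n)) {β : Cn n [⋀^Fin 2]→L[ℝ] ℝ}
    (hβ : ∀ v, v ≠ 0 → 0 < β ![v, Complex.I • v]) : 0 < density b β := by
  refine Real.sqrt_pos.2 (abs_pos.2 ?_)
  rw [← LinearMap.BilinForm.nondegenerate_iff_det_ne_zero]
  refine ⟨fun v hv => ?_, fun v hv => ?_⟩ <;>
  · by_contra hne
    exact (hβ v hne).ne' (hv v)

theorem continuous_density (b : Module.Basis (Fin N) ℝ (Cn n)) :
    Continuous (density b) := by
  refine Real.continuous_sqrt.comp (continuous_abs.comp (Continuous.matrix_det ?_))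
  refine continuous_matrix fun i j => ?_
  simp only [LinearMap.BilinForm.toMatrix_apply, hermitianBilin_apply]
  exact (ContinuousAlternatingMap.apply ℝ (Cn n) ℝ ![b i, Complex.I • b j]).continuous

theorem pullbackForm_symm_pos [IsManifold 𝓘(ℂ, Cn n) ω X] (F : HermitianMetric n X)
    {e : OpenPartialHomeomorph X (Cn n)}
    (he : e ∈ atlas (Cn n) X) {z : Cn n} (hz : z ∈ e.target) {v : Cn n} (hv : v ≠ 0) :
    0 < pullbackForm (n := n) e.symm F.form z ![v, Complex.I • v] := by
  have h1 : MDifferentiableAt 𝓘(ℂ, Cn n) 𝓘(ℂ, Cn n) e.symm z :=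
    (contMDiffAt_symm_of_mem_maximalAtlas (n := ω) (IsManifold.subset_maximalAtlas he)
      hz).mdifferentiableAt (by simp)
  have h2 : MDifferentiableAt 𝓘(ℂ, Cn n) 𝓘(ℂ, Cn n) e (e.symm z) :=
    (contMDiffAt_of_mem_maximalAtlas (n := ω) (IsManifold.subset_maximalAtlas he)
      (e.map_target hz)).mdifferentiableAt (by simp)
  have hev : e ∘ e.symm =ᶠ[nhds z] id := e.eventually_right_inverse hz
  have h3 := realDifferential_comp h2 h1
  rw [realDifferential_congr hev, realDifferential_id] at h3
  have h4 : realDifferential (n := n) e.symm z v ≠ 0 := fun h0 => hv (by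
    have := DFunLike.congr_fun h3 v
    rw [ContinuousLinearMap.comp_apply, h0, map_zero] at this
    exact this)
  have h5 := F.pos (e.symm z) _ h4
  rw [← realDifferential_I_smul] at h5
  convert! h5 using 1
  rw [pullbackForm, ContinuousAlternatingMap.compContinuousLinearMap_apply]
  congr 1
  ext i
  fin_cases i <;> rfl

/-! ### Homogeneous manifolds -/

theorem exists_isLocalSymmetry {Y : Type*} [TopologicalSpace Y]
    [ChartedSpace (Cn n) Y] {G : Type*} [Group G] [MulAction G Y] {π : Y → X}
    (hX : IsHomogeneous n G π) {F : HermitianMetric n X} (hF : F.IsInvariant G π) (x₁ x₂ : X) :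
    ∃ (χ : X → X) (U : Set X), IsLocalSymmetry F χ U ∧ x₁ ∈ U ∧ χ x₁ = x₂ := by
  obtain ⟨y₁, rfl⟩ := hX.surjective x₁
  obtain ⟨y₂, rfl⟩ := hX.surjective x₂
  obtain ⟨g, rfl⟩ := hX.transitive.exists_smul_eq y₁ y₂
  obtain ⟨Φ, hΦ, hEq⟩ := hX.isLocalDiffeomorph y₁
  have hπ : ContMDiff 𝓘(ℂ, Cn n) 𝓘(ℂ, Cn n) ω π := hX.isLocalDiffeomorph.contMDiff
  have hπ' (y : Y) : MDifferentiableAt 𝓘(ℂ, Cn n) 𝓘(ℂ, Cn n) π y :=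
    hπ.mdifferentiable (by simp) y
  have hg (y : Y) : MDifferentiableAt 𝓘(ℂ, Cn n) 𝓘(ℂ, Cn n) (fun y : Y => g • y) y :=
    (hX.holomorphic_smul g).mdifferentiable (by simp) y
  have hinv (x : X) (hx : x ∈ Φ.target) : π (Φ.invFun x) = x :=
    (hEq (Φ.map_target' hx)).trans (Φ.right_inv' hx)
  have hmem : π y₁ ∈ Φ.target := by
    rw [hEq hΦ]
    exact Φ.map_source' hΦ
  refine ⟨π ∘ (fun y : Y => g • y) ∘ Φ.invFun, Φ.target, ⟨Φ.open_target,
    (hπ.comp (hX.holomorphic_smul g)).comp_contMDiffOn Φ.contMDiffOn_invFun, fun x hx => ?_⟩,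
    hmem, ?_⟩
  · have hs : MDifferentiableAt 𝓘(ℂ, Cn n) 𝓘(ℂ, Cn n) Φ.invFun x :=
      (Φ.contMDiffOn_invFun.contMDiffAt (Φ.open_target.mem_nhds hx)).mdifferentiableAt (by simp)
    have hev : π ∘ Φ.invFun =ᶠ[nhds x] id := by
      filter_upwards [Φ.open_target.mem_nhds hx] with x' hx' using hinv x' hx'
    calc pullbackForm (n := n) (π ∘ (fun y : Y => g • y) ∘ Φ.invFun) F.form x
        = pullbackForm (n := n) ((fun y : Y => g • y) ∘ Φ.invFun)
            (pullbackForm (n := n) π F.form) x :=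
          pullbackForm_comp (hπ' _) ((hg _).comp x hs) _
      _ = pullbackForm (n := n) Φ.invFun (pullbackForm (n := n) (fun y : Y => g • y)
            (pullbackForm (n := n) π F.form)) x := pullbackForm_comp (hg _) hs _
      _ = pullbackForm (n := n) Φ.invFun (pullbackForm (n := n) π F.form) x := by rw [hF g]
      _ = pullbackForm (n := n) (π ∘ Φ.invFun) F.form x := (pullbackForm_comp (hπ' _) hs _).symm
      _ = pullbackForm (n := n) id F.form x := pullbackForm_congr hev _
      _ = F.form x := pullbackForm_id _ x
  · have : Φ.invFun (π y₁) = y₁ := by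
      rw [hEq hΦ]
      exact Φ.left_inv' hΦ
    simp only [Function.comp_apply, this]

/-- On a compact homogeneous manifold, an invariant Hermitian metric satisfies
`∂∂̄F^k = 0` for `k = n - 1`. -/
theorem dolbeault_dolbeaultPow_eq_zero [IsManifold 𝓘(ℂ, Cn n) ω X] [T2Space X] [CompactSpace X]
    {Y : Type*} [TopologicalSpace Y] [ChartedSpace (Cn n) Y] {G : Type*} [Group G] [MulAction G Y]
    {π : Y → X} (hX : IsHomogeneous n G π) {F : HermitianMetric n X} (hF : F.IsInvariant G π)
    (s t : ℂ) {k : ℕ} (b : Module.Basis (Fin (2 * k + 1 + 1)) ℝ (Cn n))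
    {e : OpenPartialHomeomorph X (Cn n)} (he : e ∈ atlas (Cn n) X) {z : Cn n} (hz : z ∈ e.target) :
    dolbeault t (dolbeaultPow F s k e) z = 0 := by
  have : Nonempty X := ⟨e.symm z⟩
  let w (e : OpenPartialHomeomorph X (Cn n)) (z : Cn n) : ℝ :=
    density b (pullbackForm (n := n) e.symm F.form z)
  have hpos : ∀ e ∈ atlas (Cn n) X, ∀ z ∈ e.target, 0 < w e z := fun e he z hz =>
    density_pos b fun v hv => pullbackForm_symm_pos F he hz hv
  let c : ℂ := (w e z)⁻¹ • dolbeault t (dolbeaultPow F s k e) z b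
  have hconst : ∀ e' ∈ atlas (Cn n) X, ∀ z' ∈ e'.target,
      dolbeault t (dolbeaultPow F s k e') z' b = w e' z' • c := by
    intro e' he' z' hz'
    obtain ⟨χ, U, hχ, hxU, hχx⟩ := exists_isLocalSymmetry hX hF (e'.symm z') (e.symm z)
    have hread : z' ∈ readDomain χ U e' e :=
      ⟨hz', hxU, by rw [Set.mem_preimage, hχx]; exact e.map_target hz⟩
    have hval : (e ∘ χ ∘ e'.symm) z' = z := by
      rw [Function.comp_apply, Function.comp_apply, hχx, e.right_inv hz]
    have hI := fderiv_real_I_smul ((hχ.contDiffAt he' he hread).differentiableAt (by simp))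
    have hw : w e' z' = (fderiv ℝ (e ∘ χ ∘ e'.symm) z').det * w e z := by
      have := hχ.pullbackForm_symm he' he hread
      rw [hχx, e.right_inv hz] at this
      change density b _ = _
      rw [this, density_comp b _ hI, abs_of_nonneg (det_nonneg_of_I_smul _ hI)]
    rw [hχ.dolbeault_dolbeaultPow he' he s t k hread, hval, hw, mul_smul,
      smul_inv_smul₀ (hpos e he z hz).ne', Complex.real_smul,
      ContinuousAlternatingMap.compContinuousLinearMap_apply]
    exact apply_map_basis_eq_det_smul b _ _
  have hc : c = 0 := const_eq_zero_of_dolbeault_eq t (isCompatibleForm_dolbeaultPow F s k) b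
    (fun e he => (continuous_density b).comp_continuousOn (F.smooth e he).continuousOn) hpos hconst
  have hzero := hconst e he z hz
  rw [hc, smul_zero] at hzero
  apply ContinuousAlternatingMap.toAlternatingMap_injective
  refine Module.Basis.ext_alternating b fun K hK => ?_
  have h1 := (dolbeault t (dolbeaultPow F s k e) z).toAlternatingMap.map_perm b
    (Equiv.ofBijective K (Finite.injective_iff_bijective.1 hK))
  have h2 : (dolbeault t (dolbeaultPow F s k e) z).toAlternatingMap b = 0 := hzero
  rw [h2, smul_zero] at h1
  exact h1

end KGauduchon

end

open KGauduchon in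
theorem corollary2p3 (n : ℕ) (hn : 3 ≤ n)
    (X : Type*) [TopologicalSpace X] [ChartedSpace (Cn n) X] [IsManifold 𝓘(ℂ, Cn n) ω X]
    [T2Space X] [CompactSpace X]
    (Y : Type*) [TopologicalSpace Y] [ChartedSpace (Cn n) Y] [IsManifold 𝓘(ℂ, Cn n) ω Y]
    (G : Type*) [Group G] [MulAction G Y]
    (π : Y → X) (hX : IsHomogeneous n G π)
    (F : HermitianMetric n X) (hF : F.IsInvariant G π)
    (h : F.IsSKT ∨ F.IsAsthenoKahler) :
    ∀ k : ℕ, 1 ≤ k → k ≤ n - 1 → F.IsGauduchon k := by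
  intro k hk hkn e he z hz
  have hfin : Module.finrank ℝ (Cn n) = 2 * (n - 1) + 1 + 1 := by
    rw [finrank_real_of_complex, finrank_euclideanSpace, Fintype.card_fin]
    omega
  let b := Module.finBasisOfFinrankEq ℝ (Cn n) hfin
  have hC : ContDiffAt ℝ 2 (F.inChart e) z :=
    ((contDiffOn_inChart F he).contDiffAt (e.open_target.mem_nhds hz)).of_le
      ENat.LEInfty.out
  rw [del_eq_dolbeault, delbar_eq_dolbeault]
  refine gauduchon_of_balance b hn hC
    (dolbeault_dolbeaultPow_eq_zero hX hF Complex.I (-Complex.I) b he hz) ?_ k hk hkn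
  refine h.imp (fun h => ?_) fun h => ?_
  · rw [← delbar_eq_dolbeault, ← del_eq_dolbeault]
    exact h e he z hz
  · rw [← delbar_eq_dolbeault, ← del_eq_dolbeault]
    exact h e he z hz
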